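/- **Syntax and semantics.** For a finite set $AP$ of atomic propositions, a *trace* over $AP$ is an infinite word $w\in(2^{AP})^{\omega}$ and a *team* over $AP$ is a set $\mathcal L$ of traces over $AP$; $\mathcal L_{\ge i}$ is the set of the suffixes $w_{\ge i}=w(i)w(i+1)\cdots$ with $w\in\mathcal L$. Formulas of $\mathrm{InqLTL}(\sim)$ over $AP$ are given by $$\varphi ::= \bot \mid p \mid \varphi\vee\varphi \mid \varphi\wedge\varphi \mid \varphi\to\varphi \mid \mathsf X\varphi \mid \varphi\,\mathsf U\,\varphi \mid \varphi\,\mathsf R\,\varphi \mid {\sim}\varphi \qquad (p\in AP),$$ and satisfaction by a team is defined as follows: $\mathcal L\models\bot$ iff $\mathcal L=\emptyset$; $\mathcal L\models p$ iff $p\in w(0)$ for all $w\in\mathcal L$; $\mathcal L\models\varphi_1\vee\varphi_2$ iff $\mathcal L\models\varphi_1$ or $\mathcal L\models\varphi_2$; $\mathcal L\models\varphi_1\wedge\varphi_2$ iff $\mathcal L\models\varphi_1$ and $\mathcal L\models\varphi_2$; $\mathcal L\models\varphi_1\to\varphi_2$ iff for all $\mathcal L'\subseteq\mathcal L$, $\mathcal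 L'\models\varphi_1$ implies $\mathcal L'\models\varphi_2$; $\mathcal L\models\mathsf X\varphi$ iff $\mathcal L_{\ge1}\models\varphi$; $\mathcal L\models\varphi_1\mathsf U\varphi_2$ iff for some $i\ge0$, $\mathcal L_{\ge i}\models\varphi_2$ and $\mathcal L_{\ge k}\models\varphi_1$ for all $0\le k<i$; $\mathcal L\models\varphi_1\mathsf R\varphi_2$ iff for each $i\ge0$, $\mathcal L_{\ge i}\models\varphi_2$ or $\mathcal L_{\ge k}\models\varphi_1$ for some $0\le k<i$; $\mathcal L\models{\sim}\varphi$ iff $\mathcal L\not\models\varphi$. **Decision problems.** *Satisfiability of $\mathrm{InqLTL}(\sim)$*: given a finite set $AP$ and a formula $\varphi$ over $AP$, is there a nonempty team over $AP$ that satisfies $\varphi$? *Model checking of $\mathrm{InqLTL}(\sim)$*: given a finite set $AP$, a finite Kripke structure $\mathcal K=\langle S,S_0,R,\mathrm{Lab}\rangle$ over $AP$ (with $S$ nonempty, $S_0\subseteq S$, $R\subseteq S\times S$ left-total and $\mathrm{Lab}:S\to2^{AP}$) and a formula $\varphi$ over $AP$, does $\mathcal L(\mathcal K)\models\varphi$ hold,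 where $\mathcal L(\mathcal K)$ is the set of the traces $\mathrm{Lab}(s_0)\mathrm{Lab}(s_1)\cdots$ with $s_0\in S_0$ and $(s_i,s_{i+1})\in R$ for all $i\ge 0$? *Truth in second-order arithmetic*: given a sentence of second-order predicate logic with equality over the signature $(<,+,*,\in)$, with variables for natural numbers and variables for sets of natural numbers, is it true over $\mathbb N$ under the standard interpretation? **Theorem.** Model checking and satisfiability of $\mathrm{InqLTL}(\sim)$ are undecidable. Moreover, truth in second-order arithmetic is reducible, by a computable many-one reduction, to model checking of $\mathrm{InqLTL}(\sim)$ and to satisfiability of $\mathrm{InqLTL}(\sim)$. -/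

import Mathlib

/-! ### The logic InqLTL with Boolean negation -/

namespace InqLTL

/-- Formulas of InqLTL(∼). The atomic propositions are named by natural numbers. -/
inductive Form : Type
  | bot : Form
  | atom (p : ℕ) : Form
  | or (φ ψ : Form) : Form
  | and (φ ψ : Form) : Form
  | imp (φ ψ : Form) : Form
  | next (φ : Form) : Form
  | untl (φ ψ : Form) : Form
  | rel (φ ψ : Form) : Form
  | bneg (φ : Form) : Form

/-- A trace: an infinite word over sets of atomic propositions. -/
abbrev Trace : Type := ℕ → Set ℕ

/-- A team is a set of traces. -/
abbrev Team : Type := Set Trace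

/-- The suffix of a trace from position `i`. -/
def Trace.suffix (w : Trace) (i : ℕ) : Trace := fun j => w (i + j)

/-- The set of the suffixes from position `i` of the traces of a team. -/
def Team.suffix (L : Team) (i : ℕ) : Team := (fun w : Trace => w.suffix i) '' L

/-- The team satisfaction relation `L ⊨ φ`. -/
def Sat : Team → Form → Prop
  | L, .bot => L = ∅
  | L, .atom p => ∀ w ∈ L, p ∈ w 0
  | L, .or φ ψ => Sat L φ ∨ Sat L ψ
  | L, .and φ ψ => Sat L φ ∧ Sat L ψ
  | L, .imp φ ψ => ∀ L' : Team, L' ⊆ L → Sat L' φ → Sat L' ψ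
  | L, .next φ => Sat (Team.suffix L 1) φ
  | L, .untl φ ψ =>
      ∃ i : ℕ, Sat (Team.suffix L i) ψ ∧ ∀ k < i, Sat (Team.suffix L k) φ
  | L, .rel φ ψ =>
      ∀ i : ℕ, Sat (Team.suffix L i) ψ ∨ ∃ k < i, Sat (Team.suffix L k) φ
  | L, .bneg φ => ¬ Sat L φ

/-- `φ.Over n`: `φ` is a formula over the finite set `AP = {0, …, n - 1}`. -/
def Form.Over (n : ℕ) : Form → Prop
  | .bot => True
  | .atom p => p < n
  | .or φ ψ => φ.Over n ∧ ψ.Over n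
  | .and φ ψ => φ.Over n ∧ ψ.Over n
  | .imp φ ψ => φ.Over n ∧ ψ.Over n
  | .next φ => φ.Over n
  | .untl φ ψ => φ.Over n ∧ ψ.Over n
  | .rel φ ψ => φ.Over n ∧ ψ.Over n
  | .bneg φ => φ.Over n

/-- `L` is a set of traces over the finite set `AP = {0, …, n - 1}`. -/
def Team.Over (n : ℕ) (L : Team) : Prop := ∀ w ∈ L, ∀ i : ℕ, ∀ p ∈ w i, p < n

/-! #### Gödel numbering of formulas (a bijection with `ℕ`) -/

/-- The Gödel number of a formula. -/
def Form.toNat : Form → ℕ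
  | .bot => 0
  | .atom p => 8 * p + 1
  | .or φ ψ => 8 * Nat.pair φ.toNat ψ.toNat + 2
  | .and φ ψ => 8 * Nat.pair φ.toNat ψ.toNat + 3
  | .imp φ ψ => 8 * Nat.pair φ.toNat ψ.toNat + 4
  | .next φ => 8 * φ.toNat + 5
  | .untl φ ψ => 8 * Nat.pair φ.toNat ψ.toNat + 6
  | .rel φ ψ => 8 * Nat.pair φ.toNat ψ.toNat + 7
  | .bneg φ => 8 * φ.toNat + 8

/-- The formula with a given Gödel number. -/
def Form.ofNat : ℕ → Form
  | 0 => .bot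
  | n + 1 =>
    have hm : n / 8 < n + 1 := by omega
    have h1 : (Nat.unpair (n / 8)).1 < n + 1 := (Nat.unpair_left_le _).trans_lt hm
    have h2 : (Nat.unpair (n / 8)).2 < n + 1 := (Nat.unpair_right_le _).trans_lt hm
    match n % 8 with
    | 0 => .atom (n / 8)
    | 1 => .or (Form.ofNat (Nat.unpair (n / 8)).1) (Form.ofNat (Nat.unpair (n / 8)).2)
    | 2 => .and (Form.ofNat (Nat.unpair (n / 8)).1) (Form.ofNat (Nat.unpair (n / 8)).2)
    | 3 => .imp (Form.ofNat (Nat.unpair (n / 8)).1) (Form.ofNat (Nat.unpair (n / 8)).2)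
    | 4 => .next (Form.ofNat (n / 8))
    | 5 => .untl (Form.ofNat (Nat.unpair (n / 8)).1) (Form.ofNat (Nat.unpair (n / 8)).2)
    | 6 => .rel (Form.ofNat (Nat.unpair (n / 8)).1) (Form.ofNat (Nat.unpair (n / 8)).2)
    | _ => .bneg (Form.ofNat (n / 8))

theorem Form.ofNat_toNat (φ : Form) : Form.ofNat φ.toNat = φ := by
  induction φ with
  | bot => simp [Form.toNat, Form.ofNat]
  | atom p =>
    have h : (8 * p) / 8 = p := by omega
    have h' : (8 * p) % 8 = 0 := by omega
    rw [Form.toNat, Form.ofNat, h, h']; rfl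
  | or φ ψ h1 h2 =>
    have h (m : ℕ) : (8 * m + 1) / 8 = m := by omega
    have h' (m : ℕ) : (8 * m + 1) % 8 = 1 := by omega
    rw [Form.toNat, Form.ofNat, h, h']; simp [h1, h2]
  | and φ ψ h1 h2 =>
    have h (m : ℕ) : (8 * m + 2) / 8 = m := by omega
    have h' (m : ℕ) : (8 * m + 2) % 8 = 2 := by omega
    rw [Form.toNat, Form.ofNat, h, h']; simp [h1, h2]
  | imp φ ψ h1 h2 =>
    have h (m : ℕ) : (8 * m + 3) / 8 = m := by omega
    have h' (m : ℕ) : (8 * m + 3) % 8 = 3 := by omega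
    rw [Form.toNat, Form.ofNat, h, h']; simp [h1, h2]
  | next φ h1 =>
    have h (m : ℕ) : (8 * m + 4) / 8 = m := by omega
    have h' (m : ℕ) : (8 * m + 4) % 8 = 4 := by omega
    rw [Form.toNat, Form.ofNat, h, h']; simp [h1]
  | untl φ ψ h1 h2 =>
    have h (m : ℕ) : (8 * m + 5) / 8 = m := by omega
    have h' (m : ℕ) : (8 * m + 5) % 8 = 5 := by omega
    rw [Form.toNat, Form.ofNat, h, h']; simp [h1, h2]
  | rel φ ψ h1 h2 =>
    have h (m : ℕ) : (8 * m + 6) / 8 = m := by omega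
    have h' (m : ℕ) : (8 * m + 6) % 8 = 6 := by omega
    rw [Form.toNat, Form.ofNat, h, h']; simp [h1, h2]
  | bneg φ h1 =>
    have h (m : ℕ) : (8 * m + 7) / 8 = m := by omega
    have h' (m : ℕ) : (8 * m + 7) % 8 = 7 := by omega
    rw [Form.toNat, Form.ofNat, h, h']; simp [h1]

theorem Form.toNat_ofNat (n : ℕ) : (Form.ofNat n).toNat = n := by
  induction n using Nat.strong_induction_on with
  | _ n ih =>
    cases n with
    | zero => simp [Form.ofNat, Form.toNat]
    | succ n =>
      have hm : n / 8 < n + 1 := by omega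
      have i0 := ih _ hm
      have i1 := ih _ ((Nat.unpair_left_le _).trans_lt hm)
      have i2 := ih _ ((Nat.unpair_right_le _).trans_lt hm)
      rw [Form.ofNat]
      have hr : n % 8 < 8 := Nat.mod_lt _ (by norm_num)
      generalize hn : n % 8 = r at hr
      interval_cases r <;> simp only [Form.toNat, i0, i1, i2, Nat.pair_unpair] <;> omega

/-- The Gödel numbering as a bijection. -/
def Form.equivNat : Form ≃ ℕ :=
  ⟨Form.toNat, Form.ofNat, Form.ofNat_toNat, Form.toNat_ofNat⟩

instance : Denumerable Form := Denumerable.mk' Form.equivNat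

/-! #### Kripke structures -/

/-- Kripke structures with set of states `S` (nonempty), whose labels are sets of
atomic propositions. -/
structure Kripke (S : Type) : Type where
  nonempty : Nonempty S
  init : Set S
  R : S → S → Prop
  leftTotal : ∀ s, ∃ t, R s t
  lab : S → Set ℕ

/-- The set of traces induced by the initial paths. -/
def Kripke.traces {S : Type} (K : Kripke S) : Team :=
  {w | ∃ π : ℕ → S, π 0 ∈ K.init ∧ (∀ i, K.R (π i) (π (i + 1))) ∧ w = fun i => K.lab (π i)}

/-- Finite descriptions of finite Kripke structures: the `i`-th entry `(b, succ, lab)` of the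
list describes the state `i` (is it initial, its list of successors, the list of the
propositions that hold at it). -/
abbrev KripkeCode : Type := List (Bool × List ℕ × List ℕ)

/-- `c.IsKripkeOver n`: the code `c` describes a Kripke structure over `AP = {0, …, n - 1}`. -/
def KripkeCode.IsKripkeOver (n : ℕ) (c : KripkeCode) : Prop :=
  c ≠ [] ∧ ∀ e ∈ c, e.2.1 ≠ [] ∧ (∀ t ∈ e.2.1, t < c.length) ∧ ∀ p ∈ e.2.2, p < n

/-- The finite Kripke structure that a well-formed code describes. -/
def KripkeCode.toKripke (n : ℕ) (c : KripkeCode) (h : KripkeCode.IsKripkeOver n c) :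
    Kripke (Fin c.length) where
  nonempty := ⟨⟨0, List.length_pos_iff.2 h.1⟩⟩
  init := {s | (c.get s).1 = true}
  R := fun s t => (t : ℕ) ∈ (c.get s).2.1
  leftTotal := fun s => by
    obtain ⟨h1, h2, -⟩ := h.2 _ (List.get_mem c s)
    obtain ⟨t, ht⟩ := List.exists_mem_of_ne_nil _ h1
    exact ⟨⟨t, h2 t ht⟩, ht⟩
  lab := fun s => {p | p ∈ (c.get s).2.2}

/-! #### The two decision problems -/

/-- Satisfiability. The input is a pair of a number `n`, which stands for the finite set
`AP = {0, …, n - 1}`, and a formula over `AP`; the question is whether some nonempty set of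
traces over `AP` satisfies the formula. -/
def Satisfiability (x : ℕ × Form) : Prop :=
  x.2.Over x.1 ∧ ∃ L : Team, Team.Over x.1 L ∧ L.Nonempty ∧ Sat L x.2

/-- Model checking. The input is a triple of a number `n`, which stands for the finite set
`AP = {0, …, n - 1}`, a finite Kripke structure over `AP` and a formula over `AP`; the question
is whether the set of traces of the Kripke structure satisfies the formula. -/
def ModelChecking (x : ℕ × KripkeCode × Form) : Prop :=
  x.2.2.Over x.1 ∧
    ∃ h : KripkeCode.IsKripkeOver x.1 x.2.1, Sat (KripkeCode.toKripke x.1 x.2.1 h).traces x.2.2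

end InqLTL

/-! ### Second-order arithmetic -/

namespace SOA

/-- Terms over `+`, `*` and the number variables, which are de Bruijn indices. -/
inductive Term : Type
  | var (i : ℕ) : Term
  | add (s t : Term) : Term
  | mul (s t : Term) : Term

/-- Formulas of second-order arithmetic. Number variables and set variables are two separate
families of de Bruijn indices: `exNum`, `allNum` bind the number variable `0` of their body and
`exSet`, `allSet` bind its set variable `0`. -/
inductive Form : Type
  | lt (s t : Term) : Form
  | eq (s t : Term) : Form
  | mem (s : Term) (X : ℕ) : Form
  | not (φ : Form) : Form
  | and (φ ψ : Form) : Form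
  | or (φ ψ : Form) : Form
  | exNum (φ : Form) : Form
  | allNum (φ : Form) : Form
  | exSet (φ : Form) : Form
  | allSet (φ : Form) : Form

/-- Extend a valuation by a value for the index `0`. -/
def push {α : Type} (a : α) (g : ℕ → α) : ℕ → α
  | 0 => a
  | i + 1 => g i

/-- The value of a term in `ℕ`. -/
def Term.val (g : ℕ → ℕ) : Term → ℕ
  | .var i => g i
  | .add s t => s.val g + t.val g
  | .mul s t => s.val g * t.val g

/-- Truth of a formula over `ℕ` under a valuation `g` of the number variables and a
valuation `G` of the set variables. -/
def Holds : (ℕ → ℕ) → (ℕ → Set ℕ) → Form → Prop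
  | g, _, .lt s t => s.val g < t.val g
  | g, _, .eq s t => s.val g = t.val g
  | g, G, .mem s X => s.val g ∈ G X
  | g, G, .not φ => ¬ Holds g G φ
  | g, G, .and φ ψ => Holds g G φ ∧ Holds g G ψ
  | g, G, .or φ ψ => Holds g G φ ∨ Holds g G ψ
  | g, G, .exNum φ => ∃ n : ℕ, Holds (push n g) G φ
  | g, G, .allNum φ => ∀ n : ℕ, Holds (push n g) G φ
  | g, G, .exSet φ => ∃ A : Set ℕ, Holds g (push A G) φ
  | g, G, .allSet φ => ∀ A : Set ℕ, Holds g (push A G) φ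

/-- The least `a` such that all number variables of the term are smaller than `a`. -/
def Term.numBound : Term → ℕ
  | .var i => i + 1
  | .add s t => max s.numBound t.numBound
  | .mul s t => max s.numBound t.numBound

/-- The least `a` such that all free number variables of the formula are smaller than `a`. -/
def Form.numBound : Form → ℕ
  | .lt s t => max s.numBound t.numBound
  | .eq s t => max s.numBound t.numBound
  | .mem s _ => s.numBound
  | .not φ => φ.numBound
  | .and φ ψ => max φ.numBound ψ.numBound
  | .or φ ψ => max φ.numBound ψ.numBound
  | .exNum φ => φ.numBound - 1
  | .allNum φ => φ.numBound - 1
  | .exSet φ => φ.numBound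
  | .allSet φ => φ.numBound

/-- The least `a` such that all free set variables of the formula are smaller than `a`. -/
def Form.setBound : Form → ℕ
  | .lt _ _ => 0
  | .eq _ _ => 0
  | .mem _ X => X + 1
  | .not φ => φ.setBound
  | .and φ ψ => max φ.setBound ψ.setBound
  | .or φ ψ => max φ.setBound ψ.setBound
  | .exNum φ => φ.setBound
  | .allNum φ => φ.setBound
  | .exSet φ => φ.setBound - 1
  | .allSet φ => φ.setBound - 1

/-- A sentence is a formula without free variables. -/
def Form.IsSentence (φ : Form) : Prop := φ.numBound = 0 ∧ φ.setBound = 0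

/-- Truth in second-order arithmetic: is the given formula a sentence that is true over `ℕ`?
(The valuations are irrelevant for sentences.) -/
def Truth (φ : Form) : Prop := φ.IsSentence ∧ ∀ (g : ℕ → ℕ) (G : ℕ → Set ℕ), Holds g G φ

/-! #### Gödel numbering of terms and formulas (bijections with `ℕ`) -/

/-- The Gödel number of a term. -/
def Term.toNat : Term → ℕ
  | .var i => 3 * i
  | .add s t => 3 * Nat.pair s.toNat t.toNat + 1
  | .mul s t => 3 * Nat.pair s.toNat t.toNat + 2

/-- The term with a given Gödel number. -/
def Term.ofNat (n : ℕ) : Term :=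
  if h0 : n % 3 = 0 then .var (n / 3)
  else
    have hm : n / 3 < n := by omega
    have h1 : (Nat.unpair (n / 3)).1 < n := (Nat.unpair_left_le _).trans_lt hm
    have h2 : (Nat.unpair (n / 3)).2 < n := (Nat.unpair_right_le _).trans_lt hm
    if n % 3 = 1 then
      .add (Term.ofNat (Nat.unpair (n / 3)).1) (Term.ofNat (Nat.unpair (n / 3)).2)
    else
      .mul (Term.ofNat (Nat.unpair (n / 3)).1) (Term.ofNat (Nat.unpair (n / 3)).2)
termination_by n

theorem Term.ofNat_toNat (t : Term) : Term.ofNat t.toNat = t := by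
  induction t with
  | var i =>
    have h : (3 * i) / 3 = i := by omega
    have h' : (3 * i) % 3 = 0 := by omega
    rw [Term.toNat, Term.ofNat]; simp
  | add s t h1 h2 =>
    have h (m : ℕ) : (3 * m + 1) / 3 = m := by omega
    have h' (m : ℕ) : (3 * m + 1) % 3 = 1 := by omega
    rw [Term.toNat, Term.ofNat]; simp [h, h', h1, h2]
  | mul s t h1 h2 =>
    have h (m : ℕ) : (3 * m + 2) / 3 = m := by omega
    have h' (m : ℕ) : (3 * m + 2) % 3 = 2 := by omega
    rw [Term.toNat, Term.ofNat]; simp [h, h', h1, h2]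

theorem Term.toNat_ofNat (n : ℕ) : (Term.ofNat n).toNat = n := by
  induction n using Nat.strong_induction_on with
  | _ n ih =>
    rw [Term.ofNat]
    split
    · simp only [Term.toNat]; omega
    · have hm : n / 3 < n := by omega
      have i1 := ih _ ((Nat.unpair_left_le _).trans_lt hm)
      have i2 := ih _ ((Nat.unpair_right_le _).trans_lt hm)
      split <;> simp only [Term.toNat, i1, i2, Nat.pair_unpair] <;> omega

/-- The Gödel numbering of terms as a bijection. -/
def Term.equivNat : Term ≃ ℕ :=
  ⟨Term.toNat, Term.ofNat, Term.ofNat_toNat, Term.toNat_ofNat⟩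

instance : Denumerable Term := Denumerable.mk' Term.equivNat

/-- The Gödel number of a formula. -/
def Form.toNat : Form → ℕ
  | .lt s t => 10 * Nat.pair s.toNat t.toNat
  | .eq s t => 10 * Nat.pair s.toNat t.toNat + 1
  | .mem s X => 10 * Nat.pair s.toNat X + 2
  | .not φ => 10 * φ.toNat + 3
  | .and φ ψ => 10 * Nat.pair φ.toNat ψ.toNat + 4
  | .or φ ψ => 10 * Nat.pair φ.toNat ψ.toNat + 5
  | .exNum φ => 10 * φ.toNat + 6
  | .allNum φ => 10 * φ.toNat + 7
  | .exSet φ => 10 * φ.toNat + 8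
  | .allSet φ => 10 * φ.toNat + 9

/-- The formula with a given Gödel number. -/
def Form.ofNat (n : ℕ) : Form :=
  if h0 : n % 10 = 0 then
    .lt (Term.ofNat (Nat.unpair (n / 10)).1) (Term.ofNat (Nat.unpair (n / 10)).2)
  else
    have hm : n / 10 < n := by omega
    have h1 : (Nat.unpair (n / 10)).1 < n := (Nat.unpair_left_le _).trans_lt hm
    have h2 : (Nat.unpair (n / 10)).2 < n := (Nat.unpair_right_le _).trans_lt hm
    match n % 10 with
    | 1 => .eq (Term.ofNat (Nat.unpair (n / 10)).1) (Term.ofNat (Nat.unpair (n / 10)).2)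
    | 2 => .mem (Term.ofNat (Nat.unpair (n / 10)).1) (Nat.unpair (n / 10)).2
    | 3 => .not (Form.ofNat (n / 10))
    | 4 => .and (Form.ofNat (Nat.unpair (n / 10)).1) (Form.ofNat (Nat.unpair (n / 10)).2)
    | 5 => .or (Form.ofNat (Nat.unpair (n / 10)).1) (Form.ofNat (Nat.unpair (n / 10)).2)
    | 6 => .exNum (Form.ofNat (n / 10))
    | 7 => .allNum (Form.ofNat (n / 10))
    | 8 => .exSet (Form.ofNat (n / 10))
    | _ => .allSet (Form.ofNat (n / 10))
termination_by n

theorem Form.ofNat_toNat (φ : Form) : Form.ofNat φ.toNat = φ := by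
  have h (m j : ℕ) (hj : j < 10) : (10 * m + j) / 10 = m := by omega
  have h' (m j : ℕ) (hj : j < 10) : (10 * m + j) % 10 = j := by omega
  induction φ with
  | lt s t =>
    rw [Form.toNat, Form.ofNat]; simp [Term.ofNat_toNat]
  | eq s t =>
    rw [Form.toNat, Form.ofNat]; simp [h, h', Term.ofNat_toNat]
  | mem s X =>
    rw [Form.toNat, Form.ofNat]; simp [h, h', Term.ofNat_toNat]
  | not φ h1 =>
    rw [Form.toNat, Form.ofNat]; simp [h, h', h1]
  | and φ ψ h1 h2 =>
    rw [Form.toNat, Form.ofNat]; simp [h, h', h1, h2]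
  | or φ ψ h1 h2 =>
    rw [Form.toNat, Form.ofNat]; simp [h, h', h1, h2]
  | exNum φ h1 =>
    rw [Form.toNat, Form.ofNat]; simp [h, h', h1]
  | allNum φ h1 =>
    rw [Form.toNat, Form.ofNat]; simp [h, h', h1]
  | exSet φ h1 =>
    rw [Form.toNat, Form.ofNat]; simp [h, h', h1]
  | allSet φ h1 =>
    rw [Form.toNat, Form.ofNat]; simp [h, h', h1]

theorem Form.toNat_ofNat (n : ℕ) : (Form.ofNat n).toNat = n := by
  induction n using Nat.strong_induction_on with
  | _ n ih =>
    rw [Form.ofNat]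
    split
    · simp only [Form.toNat, Term.toNat_ofNat, Nat.pair_unpair]; omega
    · have hm : n / 10 < n := by omega
      have i0 := ih _ hm
      have i1 := ih _ ((Nat.unpair_left_le _).trans_lt hm)
      have i2 := ih _ ((Nat.unpair_right_le _).trans_lt hm)
      have hr : n % 10 < 10 := Nat.mod_lt _ (by norm_num)
      generalize hn : n % 10 = r at hr
      interval_cases r <;> simp only [Form.toNat, Term.toNat_ofNat, i0, i1, i2, Nat.pair_unpair] <;> omega

/-- The Gödel numbering of formulas as a bijection. -/
def Form.equivNat : Form ≃ ℕ :=
  ⟨Form.toNat, Form.ofNat, Form.ofNat_toNat, Form.toNat_ofNat⟩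

instance : Denumerable Form := Denumerable.mk' Form.equivNat

end SOA

/-! ### Team semantics at absolute times -/

/-! A team can store finitely many binary relations on the natural numbers, and the choice of a
subteam can act as a second-order quantifier. The trace `tr t s n m` has proposition 0 exactly at
time n, proposition 1 exactly at time m, and constantly a tag t and a sign s. It records the pair
(n, m) with sign s under the tag t. In `relTeam N d ρ` the tags below d carry each pair with exactly
the sign that `ρ` prescribes, while the tags from d to N - 1 carry each pair with both signs and are
still undecided.

Boolean negation of an inquisitive implication says that some subteam has a property. If the
property is that tags below d still carry all pairs, tag d carries each pair with exactly one sign,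
and later tags remain full, then such subteams of `relTeam N d ρ` are exactly the teams in which a
relation has been chosen for tag d (`satAt_choiceCond`). Hence `exRel` quantifies over binary
relations (`sat_exRel`). That a team contains all pairs is expressible because passing to the
subteam of traces marked now remembers the present time while the temporal operators move on
(`IsFlat.satAt_total₁`).

A number n is stored as the relation {(n, n)}, a set as the diagonal of a relation. Order and
successor are read from time; sums and products come from quantification over all relations closed
under the recursion equations. This gives a translation of second-order arithmetic (`sat_trans`).
The formula `redForm` asks for a subteam that is the full team of all `tr t s n m` with t < N and
that satisfies the translation. So a team satisfies it iff it contains the full team and the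
sentence is true (`sat_reduction`). For satisfiability the full team itself serves as a model; for
model checking a complete Kripke structure generates a superset of it.

The reduction is computable by recursion on Gödel numbers, which Kleene's recursion theorem
justifies (`Computable.of_two_calls`). For undecidability, graphs of partial recursive functions are
definable in second-order arithmetic (`definable_of_partrec`), so the halting problem reduces to
truth there, and undecidability passes along the two reductions. -/

namespace InqLTL

/-- Satisfaction of `φ` by the suffixes of the team `L` from position `i`. -/
def SatAt (L : Team) (i : ℕ) (φ : Form) : Prop := Sat (Team.suffix L i) φ

theorem Team.suffix_suffix (L : Team) (i j : ℕ) :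
    Team.suffix (Team.suffix L i) j = Team.suffix L (i + j) := by
  simp only [Team.suffix, Set.image_image]
  congr 1
  funext w k
  simp [Trace.suffix, Nat.add_assoc]

theorem Team.suffix_zero (L : Team) : Team.suffix L 0 = L := by
  have : (fun w : Trace => w.suffix 0) = id := by
    funext w k; simp [Trace.suffix]
  simp [Team.suffix, this]

theorem satAt_zero {L : Team} {φ : Form} : SatAt L 0 φ ↔ Sat L φ := by
  rw [SatAt, Team.suffix_zero]

section SatAt
variable {L : Team} {i : ℕ} {φ ψ : Form}

theorem satAt_bot : SatAt L i .bot ↔ L = ∅ := by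
  simp [SatAt, Sat, Team.suffix]

theorem satAt_atom {p : ℕ} : SatAt L i (.atom p) ↔ ∀ w ∈ L, p ∈ w i := by
  simp [SatAt, Sat, Team.suffix, Trace.suffix]

theorem satAt_or : SatAt L i (.or φ ψ) ↔ SatAt L i φ ∨ SatAt L i ψ := by
  simp [SatAt, Sat]

theorem satAt_and : SatAt L i (.and φ ψ) ↔ SatAt L i φ ∧ SatAt L i ψ := by
  simp [SatAt, Sat]

theorem satAt_bneg : SatAt L i (.bneg φ) ↔ ¬ SatAt L i φ := by
  simp [SatAt, Sat]

/-- A subteam of the suffix team is the image of a subteam of `L`, so implication may range over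
subteams of whole traces. Thus a team can be kept fixed while only the time moves. -/
theorem satAt_imp :
    SatAt L i (.imp φ ψ) ↔ ∀ L' : Team, L' ⊆ L → SatAt L' i φ → SatAt L' i ψ := by
  simp only [SatAt, Sat]
  constructor
  · intro h L' hL'
    exact h _ (Set.image_mono hL')
  · intro h L'' hL''
    obtain ⟨L', hL', rfl⟩ := Set.subset_image_iff.1 hL''
    exact h L' hL'

theorem satAt_next : SatAt L i (.next φ) ↔ SatAt L (i + 1) φ := by
  simp [SatAt, Sat, Team.suffix_suffix]

theorem satAt_untl : SatAt L i (.untl φ ψ) ↔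
    ∃ j, SatAt L (i + j) ψ ∧ ∀ k < j, SatAt L (i + k) φ := by
  simp [SatAt, Sat, Team.suffix_suffix]

end SatAt

/-! #### Derived connectives -/

namespace Form

/-- The valid formula. -/
def top : Form := .imp .bot .bot

/-- Inquisitive negation. -/
def neg (φ : Form) : Form := .imp φ .bot

/-- `φ` holds at some time from now on. -/
def ev (φ : Form) : Form := .untl top φ

/-- `φ` holds at all times from now on. -/
def alw (φ : Form) : Form := .bneg (ev (.bneg φ))

/-- Some subteam satisfies `φ`. -/
def sub (φ : Form) : Form := .bneg (.imp φ (.bneg top))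

/-- Some nonempty subteam satisfies `φ`. -/
def nesub (φ : Form) : Form := .bneg (neg φ)

/-- Conjunction of `f 0, …, f (n - 1)`. -/
def conj (n : ℕ) (f : ℕ → Form) : Form :=
  Nat.rec top (fun k φ => .and (f k) φ) n

/-- Boolean implication. -/
def bimp (φ ψ : Form) : Form := .or (.bneg φ) ψ

end Form

open Form

section SatAt
variable {L : Team} {i : ℕ} {φ ψ : Form}

theorem satAt_top : SatAt L i top := by
  simp [top, satAt_imp]

theorem satAt_ev : SatAt L i (ev φ) ↔ ∃ j, SatAt L (i + j) φ := by
  simp [ev, satAt_untl, satAt_top]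

theorem satAt_alw : SatAt L i (alw φ) ↔ ∀ j, SatAt L (i + j) φ := by
  simp [alw, satAt_ev, satAt_bneg]

theorem satAt_sub : SatAt L i (sub φ) ↔ ∃ L' ⊆ L, SatAt L' i φ := by
  simp [sub, satAt_imp, satAt_bneg, satAt_top]

theorem satAt_nesub : SatAt L i (nesub φ) ↔ ∃ L' ⊆ L, L'.Nonempty ∧ SatAt L' i φ := by
  simp only [nesub, neg, satAt_imp, satAt_bneg, satAt_bot, Set.nonempty_iff_ne_empty]
  push Not
  exact exists_congr fun L' => by tauto

theorem satAt_bimp : SatAt L i (bimp φ ψ) ↔ (SatAt L i φ → SatAt L i ψ) := by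
  simp [bimp, satAt_or, satAt_bneg, imp_iff_not_or]

theorem satAt_conj {n : ℕ} {f : ℕ → Form} :
    SatAt L i (conj n f) ↔ ∀ k < n, SatAt L i (f k) := by
  induction n with
  | zero => simp [conj, satAt_top]
  | succ n ih =>
    have : conj (n + 1) f = .and (f n) (conj n f) := rfl
    rw [this, satAt_and, ih]
    simp only [Nat.lt_succ_iff_lt_or_eq]
    constructor
    · rintro ⟨h, h'⟩ k (hk | rfl) <;> simp_all
    · exact fun h => ⟨h n (Or.inr rfl), fun k hk => h k (Or.inl hk)⟩

end SatAt

/-! #### Flat formulas -/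

/-- `φ` holds in a team iff each of its traces has the property `P`. -/
def IsFlat (φ : Form) (P : Trace → ℕ → Prop) : Prop :=
  ∀ (L : Team) (i : ℕ), SatAt L i φ ↔ ∀ w ∈ L, P w i

namespace IsFlat
variable {φ ψ : Form} {P Q : Trace → ℕ → Prop}

theorem bot : IsFlat .bot fun _ _ => False := by
  intro L i; simp [satAt_bot, Set.eq_empty_iff_forall_notMem]

theorem atom (p : ℕ) : IsFlat (.atom p) fun w i => p ∈ w i := fun _ _ => satAt_atom

theorem and (hφ : IsFlat φ P) (hψ : IsFlat ψ Q) :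
    IsFlat (.and φ ψ) fun w i => P w i ∧ Q w i := by
  intro L i
  rw [satAt_and, hφ, hψ]
  exact ⟨fun h w hw => ⟨h.1 w hw, h.2 w hw⟩, fun h => ⟨fun w hw => (h w hw).1, fun w hw => (h w hw).2⟩⟩

/-- Singleton teams test each trace separately, so between flat formulas inquisitive implication is
ordinary implication trace by trace. -/
theorem imp (hφ : IsFlat φ P) (hψ : IsFlat ψ Q) :
    IsFlat (.imp φ ψ) fun w i => P w i → Q w i := by
  intro L i
  simp only [satAt_imp, hφ _ _, hψ _ _]
  constructor
  · intro h w hw hp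
    exact h {w} (by simpa using hw) (by simpa using hp) w rfl
  · exact fun h L' hL' hp w hw => h w (hL' hw) (hp w hw)

theorem neg (hφ : IsFlat φ P) : IsFlat (neg φ) fun w i => ¬ P w i := hφ.imp bot

theorem next (hφ : IsFlat φ P) : IsFlat (.next φ) fun w i => P w (i + 1) := by
  intro L i; rw [satAt_next, hφ]

theorem alw (hφ : IsFlat φ P) : IsFlat (alw φ) fun w i => ∀ j, P w (i + j) := by
  intro L i
  simp only [satAt_alw, hφ _ _]
  exact ⟨fun h w hw j => h j w hw, fun h j w hw => h w hw j⟩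

theorem conj {n : ℕ} {f : ℕ → Form} {P : ℕ → Trace → ℕ → Prop} (h : ∀ k, IsFlat (f k) (P k)) :
    IsFlat (conj n f) fun w i => ∀ k < n, P k w i := by
  intro L i
  simp only [satAt_conj, h _ _ _]
  exact ⟨fun h w hw k hk => h k hk w hw, fun h k hk w hw => h w hw k hk⟩

/-- A single witnessing trace is already a nonempty subteam, which turns `nesub` into an existential
quantifier over traces. -/
theorem satAt_nesub (hφ : IsFlat φ P) {L : Team} {i : ℕ} :
    SatAt L i (nesub φ) ↔ ∃ w ∈ L, P w i := by
  simp only [InqLTL.satAt_nesub, hφ _ _]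
  constructor
  · rintro ⟨L', hL', ⟨w, hw⟩, h⟩
    exact ⟨w, hL' hw, h w hw⟩
  · rintro ⟨w, hw, h⟩
    exact ⟨{w}, by simpa using hw, by simp, by simpa using h⟩

end IsFlat

/-! ### Teams that store binary relations -/

/-- The trace with tag `t` and sign `s` that marks the positions `n` and `m`. -/
def tr (t : ℕ) (s : Prop) (n m : ℕ) : Trace :=
  fun i => {p | (p = 0 ∧ i = n) ∨ (p = 1 ∧ i = m) ∨ (p = 2 ∧ s) ∨ p = t + 3}

section tr
variable {t t' n n' m m' i : ℕ} {s s' : Prop}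

theorem zero_mem_tr : 0 ∈ tr t s n m i ↔ i = n := by simp [tr]

theorem one_mem_tr : 1 ∈ tr t s n m i ↔ i = m := by simp [tr]

theorem two_mem_tr : 2 ∈ tr t s n m i ↔ s := by simp [tr]

theorem tag_mem_tr : t' + 3 ∈ tr t s n m i ↔ t' = t := by simp [tr]

theorem tr_inj : tr t s n m = tr t' s' n' m' ↔ t = t' ∧ (s ↔ s') ∧ n = n' ∧ m = m' := by
  constructor
  · intro h
    have key (p i : ℕ) : p ∈ tr t s n m i ↔ p ∈ tr t' s' n' m' i := by rw [h]
    refine ⟨?_, ?_, ?_, ?_⟩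
    · simpa [tag_mem_tr] using key (t + 3) 0
    · simpa [two_mem_tr] using key 2 0
    · simpa [zero_mem_tr] using key 0 n
    · simpa [one_mem_tr] using key 1 m
  · rintro ⟨rfl, h, rfl, rfl⟩
    rw [propext h]

end tr

/-- The team in which the tags `t < d` store the relations `ρ t` and the tags `d ≤ t < N` carry
all pairs of numbers with both signs. -/
def relTeam (N d : ℕ) (ρ : ℕ → ℕ → ℕ → Prop) : Team :=
  {w | ∃ t s n m, w = tr t s n m ∧ t < N ∧ (t < d → (s ↔ ρ t n m))}

theorem mem_relTeam {N d : ℕ} {ρ : ℕ → ℕ → ℕ → Prop} {t : ℕ} {s : Prop} {n m : ℕ} :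
    tr t s n m ∈ relTeam N d ρ ↔ t < N ∧ (t < d → (s ↔ ρ t n m)) := by
  constructor
  · rintro ⟨t', s', n', m', h, h1, h2⟩
    obtain ⟨rfl, hs, rfl, rfl⟩ := tr_inj.1 h
    exact ⟨h1, fun ht => hs.trans (h2 ht)⟩
  · exact fun h => ⟨t, s, n, m, rfl, h⟩

/-- Teams all whose traces are of the form `tr t s n m`. -/
def IsTagged (L : Team) : Prop := ∀ w ∈ L, ∃ t s n m, w = tr t s n m

theorem isTagged_relTeam {N d : ℕ} {ρ : ℕ → ℕ → ℕ → Prop} : IsTagged (relTeam N d ρ) := by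
  rintro w ⟨t, s, n, m, rfl, -⟩
  exact ⟨t, s, n, m, rfl⟩

theorem IsTagged.mono {L L' : Team} (h : IsTagged L) (hL : L' ⊆ L) : IsTagged L' :=
  fun w hw => h w (hL hw)

theorem IsTagged.exists_mem {L : Team} (h : IsTagged L) {P : Trace → Prop} :
    (∃ w ∈ L, P w) ↔ ∃ t s n m, tr t s n m ∈ L ∧ P (tr t s n m) := by
  constructor
  · rintro ⟨w, hw, hp⟩
    obtain ⟨t, s, n, m, rfl⟩ := h w hw
    exact ⟨t, s, n, m, hw, hp⟩
  · rintro ⟨t, s, n, m, hw, hp⟩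
    exact ⟨_, hw, hp⟩

theorem IsTagged.forall_mem {L : Team} (h : IsTagged L) {P : Trace → Prop} :
    (∀ w ∈ L, P w) ↔ ∀ t s n m, tr t s n m ∈ L → P (tr t s n m) := by
  constructor
  · exact fun H t s n m hw => H _ hw
  · intro H w hw
    obtain ⟨t, s, n, m, rfl⟩ := h w hw
    exact H t s n m hw

namespace Form

/-- The trace has tag `t`. -/
def tag (t : ℕ) : Form := .atom (t + 3)

/-- The trace has tag `t` and positive sign. -/
def pos (t : ℕ) : Form := .and (tag t) (.atom 2)

/-- The trace has tag `t` and negative sign. -/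
def nega (t : ℕ) : Form := .and (tag t) (neg (.atom 2))

/-- At each time `p` marks a trace with property `φ`, and `q` marks such a trace at each time
from then on. -/
def total₁ (φ : Form) (p q : ℕ) : Form :=
  alw (sub (.and (.and φ (.atom p)) (alw (nesub (.atom q)))))

/-- Each pair of numbers is marked by a trace with property `φ`. -/
def total (φ : Form) : Form := .and (total₁ φ 0 1) (total₁ φ 1 0)

/-- No pair of numbers is marked by two traces with tag `t` of different signs. -/
def func (t : ℕ) : Form :=
  .bneg (sub (.and (.and (tag t) (.and (nesub (.atom 2)) (nesub (neg (.atom 2)))))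
    (.and (ev (.atom 0)) (ev (.atom 1)))))

/-- Tag `t` carries all pairs with both signs. -/
def full (t : ℕ) : Form := .and (total (pos t)) (total (nega t))

/-- The condition on tag `t` for the choice of a relation for tag `d`. -/
def choiceCond (d t : ℕ) : Form :=
  if t < d then total (tag t) else if t = d then .and (total (tag t)) (func t) else full t

/-- Existential quantification over the relation of tag `d`. -/
def exRel (N d : ℕ) (φ : Form) : Form := sub (.and (conj N (choiceCond d)) φ)

end Form

/-! ### Truth conditions for relation choice on tagged teams -/

theorem isFlat_tag (t : ℕ) : IsFlat (tag t) fun w i => t + 3 ∈ w i := .atom _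

theorem isFlat_pos (t : ℕ) : IsFlat (pos t) fun w i => t + 3 ∈ w i ∧ 2 ∈ w i :=
  (isFlat_tag t).and (.atom 2)

theorem isFlat_nega (t : ℕ) : IsFlat (nega t) fun w i => t + 3 ∈ w i ∧ 2 ∉ w i :=
  (isFlat_tag t).and (IsFlat.atom 2).neg

/-- There is only one current time, so the time n is remembered by the team: the subteam chosen at
time n has `p` at n in all its traces, and `alw` then runs through the later times n + k. The
largest such subteam is the witness in the converse. -/
theorem IsFlat.satAt_total₁ {φ : Form} {P : Trace → ℕ → Prop} (h : IsFlat φ P) {L : Team}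
    {p q : ℕ} : SatAt L 0 (total₁ φ p q) ↔
      ∀ n k, ∃ w ∈ L, P w n ∧ p ∈ w n ∧ q ∈ w (n + k) := by
  simp only [total₁, satAt_alw, satAt_sub, satAt_and, h _ _, satAt_atom,
    (IsFlat.atom q).satAt_nesub, zero_add]
  constructor
  · intro H n k
    obtain ⟨L', hL', ⟨h1, h2⟩, h3⟩ := H n
    obtain ⟨w, hw, hq⟩ := h3 k
    exact ⟨w, hL' hw, h1 w hw, h2 w hw, hq⟩
  · intro H n
    refine ⟨{w ∈ L | P w n ∧ p ∈ w n}, fun w hw => hw.1,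
      ⟨fun w hw => hw.2.1, fun w hw => hw.2.2⟩, fun k => ?_⟩
    obtain ⟨w, hw, h1, h2, h3⟩ := H n k
    exact ⟨w, ⟨hw, h1, h2⟩, h3⟩

/-- Temporal operators look only forward: `total₁ φ 0 1` reaches the pairs with n ≤ m, and
exchanging the two markers reaches those with m ≤ n. -/
theorem IsFlat.satAt_total {φ : Form} {P : Trace → ℕ → Prop} (h : IsFlat φ P) {L : Team}
    (hL : IsTagged L) {Q : ℕ → Prop → Prop} (hQ : ∀ t s n m i, P (tr t s n m) i ↔ Q t s) :
    SatAt L 0 (total φ) ↔ ∀ n m, ∃ t s, Q t s ∧ tr t s n m ∈ L := by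
  simp only [total, satAt_and, h.satAt_total₁, hL.exists_mem, hQ, zero_mem_tr, one_mem_tr]
  constructor
  · rintro ⟨h1, h2⟩ n m
    rcases le_total n m with hnm | hnm <;> obtain ⟨k, rfl⟩ := Nat.exists_eq_add_of_le hnm
    · obtain ⟨t, s, n', m', hw, hq, rfl, rfl⟩ := h1 n k
      exact ⟨t, s, hq, hw⟩
    · obtain ⟨t, s, n', m', hw, hq, rfl, rfl⟩ := h2 m k
      exact ⟨t, s, hq, hw⟩
  · intro H
    constructor
    · intro n k
      obtain ⟨t, s, hq, hw⟩ := H n (n + k)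
      exact ⟨t, s, _, _, hw, hq, rfl, rfl⟩
    · intro m k
      obtain ⟨t, s, hq, hw⟩ := H (m + k) m
      exact ⟨t, s, _, _, hw, hq, rfl, rfl⟩

theorem satAt_total_tag {L : Team} (hL : IsTagged L) {t : ℕ} :
    SatAt L 0 (total (tag t)) ↔ ∀ n m, ∃ s, tr t s n m ∈ L := by
  rw [(isFlat_tag t).satAt_total hL (Q := fun t' _ => t = t') (by simp [tag_mem_tr])]
  simp

theorem satAt_full {L : Team} (hL : IsTagged L) {t : ℕ} :
    SatAt L 0 (full t) ↔ ∀ n m s, tr t s n m ∈ L := by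
  rw [full, satAt_and,
    (isFlat_pos t).satAt_total hL (Q := fun t' s => t = t' ∧ s) (by simp [tag_mem_tr, two_mem_tr]),
    (isFlat_nega t).satAt_total hL (Q := fun t' s => t = t' ∧ ¬ s)
      (by simp [tag_mem_tr, two_mem_tr])]
  constructor
  · rintro ⟨h1, h2⟩ n m s
    by_cases hs : s
    · obtain ⟨t', s', ⟨rfl, hs'⟩, h⟩ := h1 n m
      rwa [show s = s' by simp [hs, hs']]
    · obtain ⟨t', s', ⟨rfl, hs'⟩, h⟩ := h2 n m
      rwa [show s = s' by simp [hs, hs']]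
  · exact fun h => ⟨fun n m => ⟨t, True, by simp, h _ _ _⟩, fun n m => ⟨t, False, by simp, h _ _ _⟩⟩

/-- In team semantics `ev (.atom 0)` demands one common time for all traces. A subteam with `ev
(.atom 0)` and `ev (.atom 1)` therefore marks a single pair, and the formula forbids that both signs
occur in it under tag t. -/
theorem satAt_func {L : Team} (hL : IsTagged L) {t : ℕ} :
    SatAt L 0 (func t) ↔ ∀ n m, ¬ (tr t True n m ∈ L ∧ tr t False n m ∈ L) := by
  simp only [func, satAt_bneg, satAt_sub, satAt_and, (IsFlat.atom 2).satAt_nesub,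
    (IsFlat.atom 2).neg.satAt_nesub, isFlat_tag t _ _, satAt_ev, satAt_atom, zero_add]
  constructor
  · rintro h n m ⟨h1, h2⟩
    refine h ⟨{tr t True n m, tr t False n m}, ?_, ?_⟩
    · rintro w (rfl | rfl) <;> assumption
    · simp [tag_mem_tr, two_mem_tr, zero_mem_tr, one_mem_tr]
  · rintro h ⟨L', hL', ⟨htag, h1, h2⟩, ⟨n, hn⟩, m, hm⟩
    rw [(hL.mono hL').exists_mem] at h1 h2
    obtain ⟨t1, s1, n1, m1, hw1, hs1⟩ := h1
    obtain ⟨t2, s2, n2, m2, hw2, hs2⟩ := h2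
    have a1 := tag_mem_tr.1 (htag _ hw1)
    have a2 := tag_mem_tr.1 (htag _ hw2)
    have b1 := zero_mem_tr.1 (hn _ hw1)
    have b2 := zero_mem_tr.1 (hn _ hw2)
    have c1 := one_mem_tr.1 (hm _ hw1)
    have c2 := one_mem_tr.1 (hm _ hw2)
    rw [two_mem_tr] at hs1 hs2
    subst a1 a2 b1 b2 c1 c2
    rw [eq_true hs1] at hw1
    rw [eq_false hs2] at hw2
    exact h _ _ ⟨hL' hw1, hL' hw2⟩

/-- Below d the inclusion in `relTeam N d ρ` leaves one possible sign per pair, so totality forces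
these tags to stay unchanged. At d totality gives at least one sign and `func` at most one, so the
positive traces define R. Above d, `full` keeps every trace for later choices. -/
theorem satAt_choiceCond {N d : ℕ} {ρ : ℕ → ℕ → ℕ → Prop} {L : Team} (hd : d < N)
    (hL : L ⊆ relTeam N d ρ) : SatAt L 0 (conj N (choiceCond d)) ↔
      ∃ R : ℕ → ℕ → Prop, L = relTeam N (d + 1) (Function.update ρ d R) := by
  have hT : IsTagged L := isTagged_relTeam.mono hL
  rw [satAt_conj]
  constructor
  · intro h
    refine ⟨fun n m => tr d True n m ∈ L, Set.Subset.antisymm ?_ ?_⟩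
    · intro w hw
      obtain ⟨t, s, n, m, rfl, ht, hs⟩ := hL hw
      refine mem_relTeam.2 ⟨ht, fun htd => ?_⟩
      rcases Nat.lt_succ_iff_lt_or_eq.1 htd with htd | rfl
      · simpa [Function.update_of_ne htd.ne] using hs htd
      · have hc := h t ht
        simp only [choiceCond, lt_irrefl, if_false, if_true, satAt_and, satAt_total_tag hT,
          satAt_func hT] at hc
        rw [Function.update_self]
        by_cases hs' : s
        · simpa [hs'] using hw
        · simp only [hs', false_iff] at hw ⊢
          exact fun h' => hc.2 n m ⟨h', hw⟩
    · rintro w ⟨t, s, n, m, rfl, ht, hs⟩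
      have hc := h t ht
      rcases lt_trichotomy t d with htd | rfl | htd
      · simp only [choiceCond, htd, if_true, satAt_total_tag hT] at hc
        obtain ⟨s', hs'⟩ := hc n m
        have h1 := (mem_relTeam.1 (hL hs')).2 htd
        have h2 := hs (by omega)
        rw [Function.update_of_ne htd.ne] at h2
        rwa [propext (h2.trans h1.symm)]
      · simp only [choiceCond, lt_irrefl, if_false, if_true, satAt_and, satAt_total_tag hT] at hc
        obtain ⟨s', hs'⟩ := hc.1 n m
        have h2 := hs (by omega)
        rw [Function.update_self] at h2
        by_cases hs1 : s
        · rw [eq_true hs1]; exact h2.1 hs1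
        · have : ¬ s' := fun h3 => hs1 (h2.2 (by rwa [eq_true h3] at hs'))
          rwa [show s = s' by simp [hs1, this]]
      · simp only [choiceCond, htd.not_gt, htd.ne', if_false, satAt_full hT] at hc
        exact hc n m s
  · rintro ⟨R, rfl⟩ t ht
    rcases lt_trichotomy t d with htd | rfl | htd
    · simp only [choiceCond, htd, if_true, satAt_total_tag hT]
      exact fun n m => ⟨_, mem_relTeam.2 ⟨ht, fun _ => Iff.rfl⟩⟩
    · simp only [choiceCond, lt_irrefl, if_false, if_true, satAt_and, satAt_total_tag hT,
        satAt_func hT]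
      refine ⟨fun n m => ⟨_, mem_relTeam.2 ⟨ht, fun _ => Iff.rfl⟩⟩, fun n m => ?_⟩
      simp only [mem_relTeam, Function.update_self]
      have := Nat.lt_succ_self t
      tauto
    · simp only [choiceCond, htd.not_gt, htd.ne', if_false, satAt_full hT]
      exact fun n m s => mem_relTeam.2 ⟨ht, fun h => by omega⟩

theorem relTeam_update_subset {N d : ℕ} {ρ : ℕ → ℕ → ℕ → Prop} {R : ℕ → ℕ → Prop} :
    relTeam N (d + 1) (Function.update ρ d R) ⊆ relTeam N d ρ := by
  rintro w ⟨t, s, n, m, rfl, ht, hs⟩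
  refine mem_relTeam.2 ⟨ht, fun h => ?_⟩
  simpa [Function.update_of_ne h.ne] using hs (by omega)

/-- Fixing a relation for tag d only removes traces, so every choice of R is realised by a subteam;
conversely the choice condition admits no other subteams. -/
theorem sat_exRel {N d : ℕ} {ρ : ℕ → ℕ → ℕ → Prop} {φ : Form} (hd : d < N) :
    SatAt (relTeam N d ρ) 0 (exRel N d φ) ↔
      ∃ R, SatAt (relTeam N (d + 1) (Function.update ρ d R)) 0 φ := by
  simp only [exRel, satAt_sub, satAt_and]
  constructor
  · rintro ⟨L, hL, h1, h2⟩
    obtain ⟨R, rfl⟩ := (satAt_choiceCond hd hL).1 h1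
    exact ⟨R, h2⟩
  · rintro ⟨R, h⟩
    exact ⟨_, relTeam_update_subset, (satAt_choiceCond hd relTeam_update_subset).2 ⟨R, rfl⟩, h⟩

end InqLTL

namespace InqLTL

open Form

/-! #### Numbers and arithmetic -/

/-- The relation that represents the number `n`. -/
def numRel (n : ℕ) : ℕ → ℕ → Prop := fun a b => a = n ∧ b = n

namespace Form

/-- The time is the number stored by tag `x`. -/
def now (x : ℕ) : Form := .imp (pos x) (.atom 0)

/-- Tag `x` stores a number. -/
def isNum (x : ℕ) : Form :=
  .and (nesub (pos x)) (ev (.imp (pos x) (.and (.atom 0) (.atom 1))))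

/-- The number stored by tag `y` is the successor of the number stored by tag `x`. -/
def succ (x y : ℕ) : Form := ev (.and (now x) (.next (now y)))

/-- The number stored by tag `x` is less than the number stored by tag `y`. -/
def lt (x y : ℕ) : Form := ev (.and (now x) (.next (ev (now y))))

/-- The tags `x` and `y` store the same number. -/
def eq (x y : ℕ) : Form := ev (.and (now x) (now y))

/-- The relation stored by tag `r` holds for the numbers stored by the tags `x` and `y`. -/
def holds (r x y : ℕ) : Form :=
  sub (.and (.and (nesub (pos r)) (.and (nesub (pos x)) (nesub (pos y))))
    (.and (ev (.and (now x) (now r))) (ev (.and (now y) (.imp (pos r) (.atom 1))))))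

/-- Universal quantification over the relation of tag `d`. -/
def allRel (N d : ℕ) (φ : Form) : Form := .bneg (exRel N d (.bneg φ))

/-- Existential quantification over the number of tag `d`. -/
def exNum (N d : ℕ) (φ : Form) : Form := exRel N d (.and (isNum d) φ)

/-- Universal quantification over the number of tag `d`. -/
def allNum (N d : ℕ) (φ : Form) : Form := .bneg (exNum N d (.bneg φ))

/-- The number of tag `z` is the sum of those of the tags `x` and `y`. -/
def add (N d x y z : ℕ) : Form :=
  allRel N d (bimp
    (.and (allNum N (d + 1) (bimp (now (d + 1)) (holds d (d + 1) x)))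
      (allNum N (d + 1) (allNum N (d + 2) (allNum N (d + 3) (allNum N (d + 4)
        (bimp (.and (holds d (d + 1) (d + 2)) (.and (succ (d + 1) (d + 3)) (succ (d + 2) (d + 4))))
          (holds d (d + 3) (d + 4))))))))
    (holds d y z))

/-- The number of tag `z` is the product of those of the tags `x` and `y`. -/
def mul (N d x y z : ℕ) : Form :=
  allRel N d (bimp
    (.and (allNum N (d + 1) (bimp (now (d + 1)) (holds d (d + 1) (d + 1))))
      (allNum N (d + 1) (allNum N (d + 2) (allNum N (d + 3) (allNum N (d + 4)
        (bimp (.and (holds d (d + 1) (d + 2))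
            (.and (succ (d + 1) (d + 3)) (add N (d + 5) (d + 2) x (d + 4))))
          (holds d (d + 3) (d + 4))))))))
    (holds d y z))

end Form

/-! ### Truth conditions of the arithmetic formulas -/

section
variable {N d : ℕ} {ρ : ℕ → ℕ → ℕ → Prop}

theorem sat_allRel {φ : Form} (hd : d < N) :
    SatAt (relTeam N d ρ) 0 (allRel N d φ) ↔
      ∀ R, SatAt (relTeam N (d + 1) (Function.update ρ d R)) 0 φ := by
  simp [allRel, satAt_bneg, sat_exRel hd]

theorem exists_pos_iff {L : Team} {x i : ℕ} (hL : IsTagged L) :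
    SatAt L i (nesub (pos x)) ↔ ∃ n m, tr x True n m ∈ L := by
  rw [(isFlat_pos x).satAt_nesub, hL.exists_mem]
  simp only [tag_mem_tr, two_mem_tr]
  constructor
  · rintro ⟨t, s, n, m, h, rfl, hs⟩
    rw [eq_true hs] at h
    exact ⟨n, m, h⟩
  · rintro ⟨n, m, h⟩
    exact ⟨x, True, n, m, h, rfl, trivial⟩

theorem forall_pos_iff {L : Team} {x i : ℕ} (hL : IsTagged L) {φ : Form}
    {P : Trace → ℕ → Prop} (hφ : IsFlat φ P) :
    SatAt L i (.imp (pos x) φ) ↔ ∀ n m, tr x True n m ∈ L → P (tr x True n m) i := by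
  rw [(isFlat_pos x).imp hφ, hL.forall_mem]
  simp only [tag_mem_tr, two_mem_tr]
  constructor
  · exact fun h n m hw => h _ _ _ _ hw ⟨rfl, trivial⟩
  · rintro h t s n m hw ⟨rfl, hs⟩
    rw [eq_true hs] at hw ⊢
    exact h n m hw

/-- One time j must carry both markers of all positive traces of tag x, so the relation is contained
in {(j, j)}; the `nesub` clause excludes the empty relation. -/
theorem sat_isNum {x : ℕ} (hx : x < d) (hd : d ≤ N) :
    SatAt (relTeam N d ρ) 0 (isNum x) ↔ ∃ n, ρ x = numRel n := by
  have hT : IsTagged (relTeam N d ρ) := isTagged_relTeam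
  simp only [isNum, satAt_and, exists_pos_iff hT, satAt_ev,
    forall_pos_iff hT ((IsFlat.atom 0).and (.atom 1)), mem_relTeam, zero_mem_tr, one_mem_tr,
    zero_add, hx, hx.trans_le hd, true_and, true_imp_iff, true_iff]
  constructor
  · rintro ⟨⟨n, m, h⟩, j, hj⟩
    refine ⟨j, ?_⟩
    funext a b
    refine propext ⟨fun hab => ?_, ?_⟩
    · obtain ⟨rfl, rfl⟩ := hj a b hab
      exact ⟨rfl, rfl⟩
    · rintro ⟨rfl, rfl⟩
      obtain ⟨rfl, rfl⟩ := hj n m h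
      exact h
  · rintro ⟨n, h⟩
    rw [h]
    exact ⟨⟨n, n, rfl, rfl⟩, n, fun a b hab => ⟨hab.1.symm, hab.2.symm⟩⟩

/-- Stated for subteams because `holds` evaluates `now` inside one. The subteam must keep the trace
that stores n, as otherwise the implication in `now` would hold vacuously at every time. -/
theorem satAt_now {L : Team} (hL : L ⊆ relTeam N d ρ) {x n i : ℕ} (hx : x < d)
    (hρ : ρ x = numRel n) (hn : tr x True n n ∈ L) : SatAt L i (now x) ↔ i = n := by
  rw [now, forall_pos_iff (isTagged_relTeam.mono hL) (.atom 0)]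
  simp only [zero_mem_tr]
  constructor
  · exact fun h => h _ _ hn
  · rintro rfl a b hab
    have := (mem_relTeam.1 (hL hab)).2 hx
    rw [hρ] at this
    exact (this.1 trivial).1.symm

theorem numRel_mem {x n : ℕ} (hx : x < d) (hd : d ≤ N) (hρ : ρ x = numRel n) :
    tr x True n n ∈ relTeam N d ρ :=
  mem_relTeam.2 ⟨hx.trans_le hd, fun _ => by simp [hρ, numRel]⟩

theorem sat_now {x n i : ℕ} (hd : d ≤ N) (hx : x < d) (hn : ρ x = numRel n) :
    SatAt (relTeam N d ρ) i (now x) ↔ i = n :=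
  satAt_now le_rfl hx hn (numRel_mem hx hd hn)

theorem sat_succ {x y n m : ℕ} (hd : d ≤ N) (hx : x < d) (hn : ρ x = numRel n)
    (hy : y < d) (hm : ρ y = numRel m) :
    SatAt (relTeam N d ρ) 0 (succ x y) ↔ m = n + 1 := by
  simp [succ, satAt_ev, satAt_and, satAt_next, sat_now hd hx hn, sat_now hd hy hm, eq_comm]

theorem sat_lt {x y n m : ℕ} (hd : d ≤ N) (hx : x < d) (hn : ρ x = numRel n)
    (hy : y < d) (hm : ρ y = numRel m) :
    SatAt (relTeam N d ρ) 0 (Form.lt x y) ↔ n < m := by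
  simp only [Form.lt, satAt_ev, satAt_and, satAt_next, sat_now hd hx hn, sat_now hd hy hm,
    zero_add, exists_eq_left]
  exact ⟨fun ⟨j, h⟩ => by omega, fun h => ⟨m - (n + 1), by omega⟩⟩

theorem sat_eq {x y n m : ℕ} (hd : d ≤ N) (hx : x < d) (hn : ρ x = numRel n)
    (hy : y < d) (hm : ρ y = numRel m) :
    SatAt (relTeam N d ρ) 0 (Form.eq x y) ↔ n = m := by
  simp [Form.eq, satAt_ev, satAt_and, sat_now hd hx hn, sat_now hd hy hm]

/-- The subteam isolates one pair of the relation: at the time stored by x all its positive r-traces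
show marker 0, and at the time stored by y they show marker 1. The `nesub` clauses exclude vacuous
truth, so some positive r-trace marks exactly (n, m). -/
theorem sat_holds {x y n m : ℕ} (hd : d ≤ N) (hx : x < d) (hn : ρ x = numRel n)
    (hy : y < d) (hm : ρ y = numRel m) {r : ℕ} (hr : r < d) :
    SatAt (relTeam N d ρ) 0 (holds r x y) ↔ ρ r n m := by
  simp only [holds, satAt_sub, satAt_and, satAt_ev, zero_add]
  constructor
  · rintro ⟨L, hL, ⟨hr', hx', hy'⟩, ⟨i, hi, hi'⟩, j, hj, hj'⟩
    have hT := isTagged_relTeam.mono hL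
    rw [exists_pos_iff hT] at hr' hx' hy'
    obtain ⟨a, b, hab⟩ := hr'
    have hnL : tr x True n n ∈ L := by
      obtain ⟨a, b, hab⟩ := hx'
      have := (mem_relTeam.1 (hL hab)).2 hx
      rw [hn] at this
      obtain ⟨rfl, rfl⟩ := this.1 trivial
      exact hab
    have hmL : tr y True m m ∈ L := by
      obtain ⟨a, b, hab⟩ := hy'
      have := (mem_relTeam.1 (hL hab)).2 hy
      rw [hm] at this
      obtain ⟨rfl, rfl⟩ := this.1 trivial
      exact hab
    rw [satAt_now hL hx hn hnL] at hi
    rw [satAt_now hL hy hm hmL] at hj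
    rw [now, forall_pos_iff hT (.atom 0)] at hi'
    rw [forall_pos_iff hT (.atom 1)] at hj'
    have h1 := zero_mem_tr.1 (hi' a b hab)
    have h2 := one_mem_tr.1 (hj' a b hab)
    subst hi hj h1 h2
    exact ((mem_relTeam.1 (hL hab)).2 hr).1 trivial
  · intro h
    -- Only the positive r-traces that mark another pair are discarded.
    let L : Team := {w ∈ relTeam N d ρ | r + 3 ∈ w 0 ∧ 2 ∈ w 0 → 0 ∈ w n ∧ 1 ∈ w m}
    have hL : L ⊆ relTeam N d ρ := fun w hw => hw.1
    have hT := isTagged_relTeam.mono hL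
    have hrL : tr r True n m ∈ L :=
      ⟨mem_relTeam.2 ⟨hr.trans_le hd, fun _ => by simpa using h⟩,
        fun _ => by simp [zero_mem_tr, one_mem_tr]⟩
    have hnL : tr x True n n ∈ L := by
      refine ⟨numRel_mem hx hd hn, ?_⟩
      -- The tags r and x may coincide. In that case `h` forces m = n, so the trace storing n
      -- survives the filter.
      rintro ⟨h1, -⟩
      rw [tag_mem_tr] at h1
      subst h1
      rw [hn] at h
      simp [zero_mem_tr, one_mem_tr, h.2]
    have hmL : tr y True m m ∈ L := by
      refine ⟨numRel_mem hy hd hm, ?_⟩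
      rintro ⟨h1, -⟩
      rw [tag_mem_tr] at h1
      subst h1
      rw [hm] at h
      simp [zero_mem_tr, one_mem_tr, h.1]
    refine ⟨L, hL, ⟨(exists_pos_iff hT).2 ⟨_, _, hrL⟩, (exists_pos_iff hT).2 ⟨_, _, hnL⟩,
      (exists_pos_iff hT).2 ⟨_, _, hmL⟩⟩, ⟨n, (satAt_now hL hx hn hnL).2 rfl, ?_⟩,
      m, (satAt_now hL hy hm hmL).2 rfl, ?_⟩
    · rw [now, forall_pos_iff hT (.atom 0)]
      exact fun a b hab => (hab.2 ⟨tag_mem_tr.2 rfl, two_mem_tr.2 trivial⟩).1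
    · rw [forall_pos_iff hT (.atom 1)]
      exact fun a b hab => (hab.2 ⟨tag_mem_tr.2 rfl, two_mem_tr.2 trivial⟩).2

theorem sat_exNum {φ : Form} (hd : d < N) :
    SatAt (relTeam N d ρ) 0 (exNum N d φ) ↔
      ∃ n, SatAt (relTeam N (d + 1) (Function.update ρ d (numRel n))) 0 φ := by
  simp only [exNum, sat_exRel hd, satAt_and, sat_isNum (Nat.lt_succ_self d) hd,
    Function.update_self]
  constructor
  · rintro ⟨_, ⟨n, rfl⟩, h⟩
    exact ⟨n, h⟩
  · rintro ⟨n, h⟩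
    exact ⟨_, ⟨n, rfl⟩, h⟩

theorem sat_allNum {φ : Form} (hd : d < N) :
    SatAt (relTeam N d ρ) 0 (allNum N d φ) ↔
      ∀ n, SatAt (relTeam N (d + 1) (Function.update ρ d (numRel n))) 0 φ := by
  simp [allNum, satAt_bneg, sat_exNum hd]

/-- The graph of k ↦ a + k is the least relation that contains (0, a) and is closed under (k, m) ↦
(k + 1, m + 1). The formula puts (b, c) in every such relation: instantiating with the graph gives
one direction, induction on b the other. Being evaluated at time 0, `now (d + 1)` says that its
number is 0. Five tags are used: R and four numbers. -/
theorem sat_add {x y z a b c : ℕ} (hd : d + 5 ≤ N) (hx : x < d) (ha : ρ x = numRel a)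
    (hy : y < d) (hb : ρ y = numRel b) (hz : z < d) (hc : ρ z = numRel c) :
    SatAt (relTeam N d ρ) 0 (add N d x y z) ↔ a + b = c := by
  rw [add, sat_allRel (by omega)]
  have key (R : ℕ → ℕ → Prop) : SatAt (relTeam N (d + 1) (Function.update ρ d R)) 0 (bimp
      (.and (allNum N (d + 1) (bimp (now (d + 1)) (holds d (d + 1) x)))
        (allNum N (d + 1) (allNum N (d + 2) (allNum N (d + 3) (allNum N (d + 4)
          (bimp (.and (holds d (d + 1) (d + 2)) (.and (succ (d + 1) (d + 3)) (succ (d + 2) (d + 4))))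
            (holds d (d + 3) (d + 4))))))))
      (holds d y z)) ↔
      ((∀ k, 0 = k → R k a) ∧
        (∀ k m k' m', R k m ∧ k' = k + 1 ∧ m' = m + 1 → R k' m') → R b c) := by
    simp (disch := omega) only [satAt_bimp, satAt_and, sat_allNum]
    refine imp_congr (and_congr (forall_congr' fun k => ?_) (forall_congr' fun k =>
      forall_congr' fun m => forall_congr' fun k' => forall_congr' fun m' => ?_)) ?_
    · rw [sat_now (n := k) (by omega) (by omega) (by simp),
        sat_holds (n := k) (m := a) (by omega) (by omega) (by simp) (by omega)
          (by simp (disch := omega) [Function.update_of_ne, ha]) (by omega)]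
      simp
    · rw [sat_succ (n := k) (m := k') (by omega) (by omega) (by simp) (by omega) (by simp),
        sat_succ (n := m) (m := m') (by omega) (by omega) (by simp) (by omega) (by simp),
        sat_holds (n := k) (m := m) (by omega) (by omega) (by simp) (by omega) (by simp) (by omega),
        sat_holds (n := k') (m := m') (by omega) (by omega) (by simp) (by omega) (by simp)
          (by omega)]
      simp (disch := omega) [Function.update_of_ne]
    · rw [sat_holds (n := b) (m := c) (by omega) (by omega)
        (by simp (disch := omega) [Function.update_of_ne, hb]) (by omega)
        (by simp (disch := omega) [Function.update_of_ne, hc]) (by omega)]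
      simp
  simp only [key]
  constructor
  · intro h
    refine h (fun k m => a + k = m) ⟨?_, ?_⟩
    · rintro k rfl; rfl
    · rintro k m k' m' ⟨rfl, rfl, rfl⟩; omega
  · rintro rfl R ⟨h0, h1⟩
    clear key hb hc
    induction b with
    | zero => exact h0 0 rfl
    | succ b ih => exact h1 _ _ _ _ ⟨ih, rfl, rfl⟩

/-- Least-relation argument again, now with base (0, 0) and step (k, m) ↦ (k + 1, m + a). The step
calls `add` from tag d + 5 on, whence the room for ten tags. -/
theorem sat_mul {x y z a b c : ℕ} (hd : d + 10 ≤ N) (hx : x < d) (ha : ρ x = numRel a)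
    (hy : y < d) (hb : ρ y = numRel b) (hz : z < d) (hc : ρ z = numRel c) :
    SatAt (relTeam N d ρ) 0 (mul N d x y z) ↔ a * b = c := by
  rw [mul, sat_allRel (by omega)]
  have key (R : ℕ → ℕ → Prop) : SatAt (relTeam N (d + 1) (Function.update ρ d R)) 0 (bimp
      (.and (allNum N (d + 1) (bimp (now (d + 1)) (holds d (d + 1) (d + 1))))
        (allNum N (d + 1) (allNum N (d + 2) (allNum N (d + 3) (allNum N (d + 4)
          (bimp (.and (holds d (d + 1) (d + 2))
              (.and (succ (d + 1) (d + 3)) (add N (d + 5) (d + 2) x (d + 4))))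
            (holds d (d + 3) (d + 4))))))))
      (holds d y z)) ↔
      ((∀ k, 0 = k → R k k) ∧
        (∀ k m k' m', R k m ∧ k' = k + 1 ∧ m + a = m' → R k' m') → R b c) := by
    simp (disch := omega) only [satAt_bimp, satAt_and, sat_allNum]
    refine imp_congr (and_congr (forall_congr' fun k => ?_) (forall_congr' fun k =>
      forall_congr' fun m => forall_congr' fun k' => forall_congr' fun m' => ?_)) ?_
    · rw [sat_now (n := k) (by omega) (by omega) (by simp),
        sat_holds (n := k) (m := k) (by omega) (by omega) (by simp) (by omega) (by simp) (by omega)]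
      simp
    · rw [sat_succ (n := k) (m := k') (by omega) (by omega) (by simp) (by omega) (by simp),
        sat_add (a := m) (b := a) (c := m') (by omega) (by omega) (by simp) (by omega)
          (by simp (disch := omega) [Function.update_of_ne, ha]) (by omega) (by simp),
        sat_holds (n := k) (m := m) (by omega) (by omega) (by simp) (by omega) (by simp) (by omega),
        sat_holds (n := k') (m := m') (by omega) (by omega) (by simp) (by omega) (by simp)
          (by omega)]
      simp (disch := omega) [Function.update_of_ne]
    · rw [sat_holds (n := b) (m := c) (by omega) (by omega)
        (by simp (disch := omega) [Function.update_of_ne, hb]) (by omega)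
        (by simp (disch := omega) [Function.update_of_ne, hc]) (by omega)]
      simp
  simp only [key]
  constructor
  · intro h
    refine h (fun k m => a * k = m) ⟨?_, ?_⟩
    · rintro k rfl; rfl
    · rintro k m k' m' ⟨rfl, rfl, rfl⟩; ring
  · rintro rfl R ⟨h0, h1⟩
    clear key hb hc
    induction b with
    | zero => exact h0 0 rfl
    | succ b ih => exact h1 _ _ _ _ ⟨ih, rfl, by ring⟩

end

/-! #### The initial team -/

namespace Form

/-- `p` holds exactly once. -/
def once (p : ℕ) : Form :=
  .and (neg (alw (neg (.atom p)))) (alw (.imp (.atom p) (.next (alw (neg (.atom p))))))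

/-- The truth value of `p` is constant. -/
def const (p : ℕ) : Form :=
  .and (.imp (.atom p) (alw (.atom p))) (.imp (neg (.atom p)) (alw (neg (.atom p))))

/-- `t` is the only tag less than `N` that holds now. -/
def onlyTag (N t : ℕ) : Form := conj N fun t' => if t' = t then tag t' else neg (tag t')

/-- Each trace of the team is of the form `tr t s n m` with `t < N`. -/
def tagged (N : ℕ) : Form :=
  .and (.and (once 0) (.and (once 1) (const 2)))
    (.and (neg (conj N fun t => neg (tag t)))
      (conj N fun t => .imp (tag t) (alw (onlyTag N t))))

/-- The team consists of all traces `tr t s n m` with `t < N`. -/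
def initial (N : ℕ) : Form := .and (tagged N) (conj N full)

end Form

/-! ### Truth condition of the formula for the initial team -/

theorem isFlat_once (p : ℕ) : IsFlat (once p) fun w i =>
    (¬ ∀ j, p ∉ w (i + j)) ∧ ∀ j, p ∈ w (i + j) → ∀ k, p ∉ w (i + j + 1 + k) :=
  (IsFlat.atom p).neg.alw.neg.and (((IsFlat.atom p).imp (IsFlat.atom p).neg.alw.next).alw)

theorem isFlat_const (p : ℕ) : IsFlat (const p) fun w i =>
    (p ∈ w i → ∀ j, p ∈ w (i + j)) ∧ (p ∉ w i → ∀ j, p ∉ w (i + j)) :=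
  ((IsFlat.atom p).imp (IsFlat.atom p).alw).and
    ((IsFlat.atom p).neg.imp (IsFlat.atom p).neg.alw)

theorem isFlat_onlyTag (N t : ℕ) :
    IsFlat (onlyTag N t) fun w i => ∀ t' < N, (t' + 3 ∈ w i ↔ t' = t) := by
  refine IsFlat.conj (f := fun t' => if t' = t then tag t' else neg (tag t'))
    (P := fun t' w i => (t' + 3 ∈ w i ↔ t' = t)) fun t' => ?_
  by_cases h : t' = t
  · simpa [h] using isFlat_tag t
  · simpa [h] using (isFlat_tag t').neg

theorem isFlat_tagged (N : ℕ) : IsFlat (tagged N) fun w i =>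
    (((¬ ∀ j, 0 ∉ w (i + j)) ∧ ∀ j, 0 ∈ w (i + j) → ∀ k, 0 ∉ w (i + j + 1 + k)) ∧
     ((¬ ∀ j, 1 ∉ w (i + j)) ∧ ∀ j, 1 ∈ w (i + j) → ∀ k, 1 ∉ w (i + j + 1 + k)) ∧
     (2 ∈ w i → ∀ j, 2 ∈ w (i + j)) ∧ (2 ∉ w i → ∀ j, 2 ∉ w (i + j))) ∧
    (¬ ∀ t < N, t + 3 ∉ w i) ∧
    ∀ t < N, t + 3 ∈ w i → ∀ j, ∀ t' < N, (t' + 3 ∈ w (i + j) ↔ t' = t) :=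
  ((isFlat_once 0).and ((isFlat_once 1).and (isFlat_const 2))).and
    ((IsFlat.conj fun t => (isFlat_tag t).neg).neg.and
      (IsFlat.conj fun t => (isFlat_tag t).imp (isFlat_onlyTag N t).alw))

theorem once_iff {A : ℕ → Prop} :
    ((¬ ∀ j, ¬ A j) ∧ ∀ j, A j → ∀ k, ¬ A (j + 1 + k)) ↔ ∃ n, ∀ j, A j ↔ j = n := by
  constructor
  · rintro ⟨h, h'⟩
    push Not at h
    obtain ⟨n, hn⟩ := h
    refine ⟨n, fun j => ⟨fun hj => ?_, fun hj => hj ▸ hn⟩⟩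
    rcases lt_trichotomy j n with hlt | heq | hlt
    · obtain ⟨k, rfl⟩ := Nat.exists_eq_add_of_le (Nat.succ_le_of_lt hlt)
      exact absurd hn (h' _ hj k)
    · exact heq
    · obtain ⟨k, rfl⟩ := Nat.exists_eq_add_of_le (Nat.succ_le_of_lt hlt)
      exact absurd hj (h' _ hn k)
  · rintro ⟨n, hn⟩
    simp only [hn]
    refine ⟨fun h => h n rfl, fun j hj k => by omega⟩

/-- The formula controls only the propositions below N + 3. By `hL` no others occur, so it
determines the traces completely. -/
theorem satAt_tagged {N : ℕ} {L : Team} (hL : Team.Over (N + 3) L) :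
    SatAt L 0 (tagged N) ↔ ∀ w ∈ L, ∃ t s n m, w = tr t s n m ∧ t < N := by
  rw [isFlat_tagged]
  refine forall₂_congr fun w hw => ?_
  simp only [zero_add, once_iff (A := fun j => 0 ∈ w j), once_iff (A := fun j => 1 ∈ w j)]
  constructor
  · rintro ⟨⟨⟨n, hn⟩, ⟨m, hm⟩, hs, hs'⟩, ht, ht'⟩
    push Not at ht
    obtain ⟨t, htN, ht⟩ := ht
    -- Since proposition 2 is constant, the sign can be read at time 0.
    refine ⟨t, 2 ∈ w 0, n, m, ?_, htN⟩
    funext i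
    ext p
    match p with
    | 0 => rw [zero_mem_tr, hn]
    | 1 => rw [one_mem_tr, hm]
    | 2 =>
      rw [two_mem_tr]
      by_cases h : 2 ∈ w 0
      · simp [h, hs h i]
      · simp [h, hs' h i]
    | p + 3 =>
      rw [tag_mem_tr]
      by_cases hp : p < N
      · exact ht' t htN ht i p hp
      · have := hL w hw i (p + 3)
        constructor
        · exact fun h => absurd (this h) (by omega)
        · rintro rfl; exact absurd htN hp
  · rintro ⟨t, s, n, m, rfl, ht⟩
    simp only [zero_mem_tr, one_mem_tr, two_mem_tr, tag_mem_tr]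
    refine ⟨⟨⟨n, fun _ => Iff.rfl⟩, ⟨m, fun _ => Iff.rfl⟩, fun h _ => h, fun h _ => h⟩,
      fun h => h t ht rfl, ?_⟩
    rintro _ _ rfl _ _ _
    rfl

/-- With d = 0 no tag is decided yet, so `relTeam N 0 ρ` does not depend on `ρ`, which may be
arbitrary. -/
theorem satAt_initial {N : ℕ} {L : Team} (hL : Team.Over (N + 3) L) (ρ : ℕ → ℕ → ℕ → Prop) :
    SatAt L 0 (initial N) ↔ L = relTeam N 0 ρ := by
  rw [initial, satAt_and, satAt_tagged hL, satAt_conj]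
  constructor
  · rintro ⟨h1, h2⟩
    have hT : IsTagged L := fun w hw => by
      obtain ⟨t, s, n, m, h, -⟩ := h1 w hw
      exact ⟨t, s, n, m, h⟩
    refine Set.Subset.antisymm ?_ ?_
    · intro w hw
      obtain ⟨t, s, n, m, h, ht⟩ := h1 w hw
      exact ⟨t, s, n, m, h, ht, by simp⟩
    · rintro w ⟨t, s, n, m, rfl, ht, -⟩
      exact (satAt_full hT).1 (h2 t ht) n m s
  · rintro rfl
    refine ⟨?_, fun t ht => (satAt_full isTagged_relTeam).2 fun n m s => mem_relTeam.2 ⟨ht, by simp⟩⟩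
    rintro w ⟨t, s, n, m, h, ht, -⟩
    exact ⟨t, s, n, m, h, ht⟩

theorem relTeam_over {N d : ℕ} {ρ : ℕ → ℕ → ℕ → Prop} : Team.Over (N + 3) (relTeam N d ρ) := by
  rintro w ⟨t, s, n, m, rfl, ht, -⟩ i p (⟨rfl, -⟩ | ⟨rfl, -⟩ | ⟨rfl, -⟩ | rfl) <;> omega

end InqLTL

namespace InqLTL

open Form

/-! #### The translation of second-order arithmetic -/

/-- The value of a term is the number of tag `z`. The number variable `i` is stored by the `i`-th
tag of the list `en`, and the tags from `d` on are free. -/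
def valForm (N : ℕ) (en : List ℕ) : ℕ → ℕ → SOA.Term → Form
  | _, z, .var i => Form.eq (en.getD i 0) z
  | d, z, .add s t =>
      exNum N d (exNum N (d + 1) (.and
        (.and (valForm N en (d + 2) d s) (valForm N en (d + 2) (d + 1) t))
        (Form.add N (d + 2) d (d + 1) z)))
  | d, z, .mul s t =>
      exNum N d (exNum N (d + 1) (.and
        (.and (valForm N en (d + 2) d s) (valForm N en (d + 2) (d + 1) t))
        (Form.mul N (d + 2) d (d + 1) z)))

/-- `ψ` holds for the values of two terms, which are stored by the tags `d` and `d + 1`. -/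
def withVals (N : ℕ) (en : List ℕ) (d : ℕ) (s t : SOA.Term) (ψ : Form) : Form :=
  exNum N d (exNum N (d + 1) (.and
    (.and (valForm N en (d + 2) d s) (valForm N en (d + 2) (d + 1) t)) ψ))

/-- The translation of a formula of second-order arithmetic whose free number and set variables
are stored by the tags of the lists `en` and `es`; the tags from `d` on are free. -/
def trans (N : ℕ) : List ℕ → List ℕ → ℕ → SOA.Form → Form
  | en, _, d, .lt s t => withVals N en d s t (Form.lt d (d + 1))
  | en, _, d, .eq s t => withVals N en d s t (Form.eq d (d + 1))
  | en, es, d, .mem s X =>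
      exNum N d (.and (valForm N en (d + 1) d s) (Form.holds (es.getD X 0) d d))
  | en, es, d, .not φ => .bneg (trans N en es d φ)
  | en, es, d, .and φ ψ => .and (trans N en es d φ) (trans N en es d ψ)
  | en, es, d, .or φ ψ => .or (trans N en es d φ) (trans N en es d ψ)
  | en, es, d, .exNum φ => exNum N d (trans N (d :: en) es (d + 1) φ)
  | en, es, d, .allNum φ => allNum N d (trans N (d :: en) es (d + 1) φ)
  | en, es, d, .exSet φ => exRel N d (trans N en (d :: es) (d + 1) φ)
  | en, es, d, .allSet φ => allRel N d (trans N en (d :: es) (d + 1) φ)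

/-- The tags of the list `en` store the values of the number variables. -/
def NumEnv (d : ℕ) (ρ : ℕ → ℕ → ℕ → Prop) (en : List ℕ) (g : ℕ → ℕ) : Prop :=
  ∀ i < en.length, en.getD i 0 < d ∧ ρ (en.getD i 0) = numRel (g i)

/-- The tags of the list `es` store the values of the set variables. -/
def SetEnv (d : ℕ) (ρ : ℕ → ℕ → ℕ → Prop) (es : List ℕ) (G : ℕ → Set ℕ) : Prop :=
  ∀ X < es.length, es.getD X 0 < d ∧ ∀ n, ρ (es.getD X 0) n n ↔ n ∈ G X

section
variable {d : ℕ} {ρ : ℕ → ℕ → ℕ → Prop} {en es : List ℕ} {g : ℕ → ℕ} {G : ℕ → Set ℕ}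
  {R : ℕ → ℕ → Prop}

theorem NumEnv.update (h : NumEnv d ρ en g) : NumEnv (d + 1) (Function.update ρ d R) en g :=
  fun i hi => ⟨(h i hi).1.trans (Nat.lt_succ_self d), by
    rw [Function.update_of_ne (h i hi).1.ne, (h i hi).2]⟩

theorem SetEnv.update (h : SetEnv d ρ es G) : SetEnv (d + 1) (Function.update ρ d R) es G :=
  fun i hi => ⟨(h i hi).1.trans (Nat.lt_succ_self d), by
    rw [Function.update_of_ne (h i hi).1.ne]; exact (h i hi).2⟩

theorem NumEnv.push (h : NumEnv d ρ en g) (n : ℕ) :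
    NumEnv (d + 1) (Function.update ρ d (numRel n)) (d :: en) (SOA.push n g) := by
  intro i hi
  cases i with
  | zero => simp [SOA.push]
  | succ i => simpa [SOA.push] using h.update i (by simpa using hi)

theorem SetEnv.push (h : SetEnv d ρ es G) {A : Set ℕ} (hA : ∀ n, R n n ↔ n ∈ A) :
    SetEnv (d + 1) (Function.update ρ d R) (d :: es) (SOA.push A G) := by
  intro i hi
  cases i with
  | zero => simpa [SOA.push] using hA
  | succ i => simpa [SOA.push] using h.update i (by simpa using hi)

end

/-- The Gödel number serves as a generous bound on the tags needed: passing to a subterm lowers `3 *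
t.toNat` by more than the two tags that are consumed, and the summand 10 leaves room for `mul`. -/
theorem sat_valForm {N : ℕ} {en : List ℕ} {g : ℕ → ℕ} (t : SOA.Term)
    (ht : t.numBound ≤ en.length) {d z c : ℕ} {ρ : ℕ → ℕ → ℕ → Prop}
    (hN : d + 3 * t.toNat + 10 ≤ N) (hg : NumEnv d ρ en g) (hz : z < d) (hc : ρ z = numRel c) :
    SatAt (relTeam N d ρ) 0 (valForm N en d z t) ↔ t.val g = c := by
  induction t generalizing d z c ρ with
  | var i =>
    obtain ⟨h1, h2⟩ := hg i (by simpa [SOA.Term.numBound] using ht)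
    rw [valForm, sat_eq (by omega) h1 h2 hz hc, SOA.Term.val]
  | add s t ihs iht =>
    have hp1 := Nat.left_le_pair s.toNat t.toNat
    have hp2 := Nat.right_le_pair s.toNat t.toNat
    simp only [SOA.Term.toNat, SOA.Term.numBound, max_le_iff] at hN ht
    rw [valForm, sat_exNum (by omega)]
    simp (disch := omega) only [sat_exNum, satAt_and]
    have key (a b : ℕ) := and_congr (and_congr
      (ihs ht.1 (z := d) (c := a) (d := d + 1 + 1) (by omega)
        (hg.update (R := numRel a)).update (by omega)
        (ρ := Function.update (Function.update ρ d (numRel a)) (d + 1) (numRel b)) (by simp))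
      (iht ht.2 (z := d + 1) (c := b) (d := d + 1 + 1) (by omega)
        (hg.update (R := numRel a)).update (by omega)
        (ρ := Function.update (Function.update ρ d (numRel a)) (d + 1) (numRel b)) (by simp)))
      (sat_add (N := N) (x := d) (y := d + 1) (z := z) (a := a) (b := b) (c := c) (d := d + 1 + 1)
        (ρ := Function.update (Function.update ρ d (numRel a)) (d + 1) (numRel b))
        (by omega) (by omega) (by simp) (by omega) (by simp) (by omega)
        (by simp (disch := omega) [Function.update_of_ne, hc]))
    refine (exists_congr fun a => exists_congr fun b => key a b).trans ?_
    simp [SOA.Term.val]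
  | mul s t ihs iht =>
    have hp1 := Nat.left_le_pair s.toNat t.toNat
    have hp2 := Nat.right_le_pair s.toNat t.toNat
    simp only [SOA.Term.toNat, SOA.Term.numBound, max_le_iff] at hN ht
    rw [valForm, sat_exNum (by omega)]
    simp (disch := omega) only [sat_exNum, satAt_and]
    have key (a b : ℕ) := and_congr (and_congr
      (ihs ht.1 (z := d) (c := a) (d := d + 1 + 1) (by omega)
        (hg.update (R := numRel a)).update (by omega)
        (ρ := Function.update (Function.update ρ d (numRel a)) (d + 1) (numRel b)) (by simp))
      (iht ht.2 (z := d + 1) (c := b) (d := d + 1 + 1) (by omega)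
        (hg.update (R := numRel a)).update (by omega)
        (ρ := Function.update (Function.update ρ d (numRel a)) (d + 1) (numRel b)) (by simp)))
      (sat_mul (N := N) (x := d) (y := d + 1) (z := z) (a := a) (b := b) (c := c) (d := d + 1 + 1)
        (ρ := Function.update (Function.update ρ d (numRel a)) (d + 1) (numRel b))
        (by omega) (by omega) (by simp) (by omega) (by simp) (by omega)
        (by simp (disch := omega) [Function.update_of_ne, hc]))
    refine (exists_congr fun a => exists_congr fun b => key a b).trans ?_
    simp [SOA.Term.val]

theorem sat_withVals {N : ℕ} {en : List ℕ} {g : ℕ → ℕ} {s t : SOA.Term}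
    (hs : s.numBound ≤ en.length) (ht : t.numBound ≤ en.length) {d : ℕ}
    {ρ : ℕ → ℕ → ℕ → Prop} (hNs : d + 3 * s.toNat + 12 ≤ N) (hNt : d + 3 * t.toNat + 12 ≤ N)
    (hg : NumEnv d ρ en g) {ψ : Form} :
    SatAt (relTeam N d ρ) 0 (withVals N en d s t ψ) ↔
      SatAt (relTeam N (d + 1 + 1) (Function.update (Function.update ρ d (numRel (s.val g)))
        (d + 1) (numRel (t.val g)))) 0 ψ := by
  rw [withVals, sat_exNum (by omega)]
  simp (disch := omega) only [sat_exNum, satAt_and]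
  have key (a b : ℕ) := and_congr (and_congr
      (sat_valForm s hs (z := d) (c := a) (d := d + 1 + 1) (N := N) (by omega)
        (hg.update (R := numRel a)).update (by omega)
        (ρ := Function.update (Function.update ρ d (numRel a)) (d + 1) (numRel b)) (by simp))
      (sat_valForm t ht (z := d + 1) (c := b) (d := d + 1 + 1) (N := N) (by omega)
        (hg.update (R := numRel a)).update (by omega)
        (ρ := Function.update (Function.update ρ d (numRel a)) (d + 1) (numRel b)) (by simp)))
      (Iff.rfl (a := SatAt (relTeam N (d + 1 + 1) (Function.update (Function.update ρ d (numRel a))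
        (d + 1) (numRel b))) 0 ψ))
  refine (exists_congr fun a => exists_congr fun b => key a b).trans ?_
  simp

/-- The lists `en` and `es` are de Bruijn environments: a quantifier allocates tag d and puts it at
the head. The bounds on free variables keep all lookups within the lists, so the default value of
`getD` never matters here. -/
theorem sat_trans {N : ℕ} (φ : SOA.Form) {en es : List ℕ} (hn : φ.numBound ≤ en.length)
    (hs : φ.setBound ≤ es.length) {d : ℕ} {ρ : ℕ → ℕ → ℕ → Prop} {g : ℕ → ℕ} {G : ℕ → Set ℕ}
    (hN : d + 3 * φ.toNat + 20 ≤ N) (hg : NumEnv d ρ en g) (hG : SetEnv d ρ es G) :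
    SatAt (relTeam N d ρ) 0 (trans N en es d φ) ↔ SOA.Holds g G φ := by
  induction φ generalizing en es d ρ g G with
  | lt s t =>
    have hp1 := Nat.left_le_pair s.toNat t.toNat
    have hp2 := Nat.right_le_pair s.toNat t.toNat
    simp only [SOA.Form.toNat, SOA.Form.numBound, max_le_iff] at hN hn
    rw [trans, sat_withVals hn.1 hn.2 (by omega) (by omega) hg,
      sat_lt (n := s.val g) (m := t.val g) (by omega) (by omega) (by simp) (by omega) (by simp),
      SOA.Holds]
  | eq s t =>
    have hp1 := Nat.left_le_pair s.toNat t.toNat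
    have hp2 := Nat.right_le_pair s.toNat t.toNat
    simp only [SOA.Form.toNat, SOA.Form.numBound, max_le_iff] at hN hn
    rw [trans, sat_withVals hn.1 hn.2 (by omega) (by omega) hg,
      sat_eq (n := s.val g) (m := t.val g) (by omega) (by omega) (by simp) (by omega) (by simp),
      SOA.Holds]
  | mem s X =>
    have hp1 := Nat.left_le_pair s.toNat X
    simp only [SOA.Form.toNat, SOA.Form.numBound] at hN hn
    obtain ⟨hX, hX'⟩ := hG X (by simpa [SOA.Form.setBound] using hs)
    rw [trans, sat_exNum (by omega)]
    simp only [satAt_and]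
    have key (a : ℕ) := and_congr
      (sat_valForm s hn (z := d) (c := a) (d := d + 1) (N := N) (by omega)
        (hg.update (R := numRel a)) (by omega) (by simp))
      (sat_holds (n := a) (m := a) (N := N) (d := d + 1) (ρ := Function.update ρ d (numRel a))
        (x := d) (y := d) (r := es.getD X 0) (by omega) (by omega) (by simp) (by omega) (by simp)
        (by omega))
    refine (exists_congr key).trans ?_
    simp only [Function.update_of_ne hX.ne, hX', exists_eq_left', SOA.Holds]
  | not φ ih =>
    simp only [SOA.Form.toNat, SOA.Form.numBound, SOA.Form.setBound] at hN hn hs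
    rw [trans, satAt_bneg, ih hn hs (by omega) hg hG, SOA.Holds]
  | and φ ψ ih1 ih2 =>
    have hp1 := Nat.left_le_pair φ.toNat ψ.toNat
    have hp2 := Nat.right_le_pair φ.toNat ψ.toNat
    simp only [SOA.Form.toNat, SOA.Form.numBound, SOA.Form.setBound, max_le_iff] at hN hn hs
    rw [trans, satAt_and, ih1 hn.1 hs.1 (by omega) hg hG, ih2 hn.2 hs.2 (by omega) hg hG,
      SOA.Holds]
  | or φ ψ ih1 ih2 =>
    have hp1 := Nat.left_le_pair φ.toNat ψ.toNat
    have hp2 := Nat.right_le_pair φ.toNat ψ.toNat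
    simp only [SOA.Form.toNat, SOA.Form.numBound, SOA.Form.setBound, max_le_iff] at hN hn hs
    rw [trans, satAt_or, ih1 hn.1 hs.1 (by omega) hg hG, ih2 hn.2 hs.2 (by omega) hg hG,
      SOA.Holds]
  | exNum φ ih =>
    simp only [SOA.Form.toNat, SOA.Form.numBound, SOA.Form.setBound] at hN hn hs
    rw [trans, sat_exNum (by omega), SOA.Holds]
    exact exists_congr fun n =>
      ih (by simp only [List.length_cons]; omega) hs (by omega) (hg.push n) hG.update
  | allNum φ ih =>
    simp only [SOA.Form.toNat, SOA.Form.numBound, SOA.Form.setBound] at hN hn hs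
    rw [trans, sat_allNum (by omega), SOA.Holds]
    exact forall_congr' fun n =>
      ih (by simp only [List.length_cons]; omega) hs (by omega) (hg.push n) hG.update
  | exSet φ ih =>
    simp only [SOA.Form.toNat, SOA.Form.numBound, SOA.Form.setBound] at hN hn hs
    rw [trans, sat_exRel (by omega), SOA.Holds]
    have key (R : ℕ → ℕ → Prop) (A : Set ℕ) (hA : ∀ n, R n n ↔ n ∈ A) :=
      ih hn (es := d :: es) (by simp only [List.length_cons]; omega) (by omega) hg.update
        (hG.push hA)
    -- Only the diagonal of R matters. Every set is the diagonal of some relation, for instance of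
    -- one that ignores its second argument.
    exact ⟨fun ⟨R, h⟩ => ⟨{n | R n n}, (key R _ fun _ => Iff.rfl).1 h⟩,
      fun ⟨A, h⟩ => ⟨_, (key (fun n _ => n ∈ A) A fun _ => Iff.rfl).2 h⟩⟩
  | allSet φ ih =>
    simp only [SOA.Form.toNat, SOA.Form.numBound, SOA.Form.setBound] at hN hn hs
    rw [trans, sat_allRel (by omega), SOA.Holds]
    have key (R : ℕ → ℕ → Prop) (A : Set ℕ) (hA : ∀ n, R n n ↔ n ∈ A) :=
      ih hn (es := d :: es) (by simp only [List.length_cons]; omega) (by omega) hg.update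
        (hG.push hA)
    exact ⟨fun h A => (key (fun n _ => n ∈ A) A fun _ => Iff.rfl).1 (h _),
      fun h R => (key R {n | R n n} fun _ => Iff.rfl).2 (h _)⟩

/-! #### The propositions of the translation -/

section Over
variable {n : ℕ} {φ ψ : Form}

theorem over_conj {k : ℕ} {f : ℕ → Form} (h : ∀ i < k, (f i).Over n) : (conj k f).Over n := by
  induction k with
  | zero => exact ⟨trivial, trivial⟩
  | succ k ih =>
    exact ⟨h k (Nat.lt_succ_self k), ih fun i hi => h i (by omega)⟩

theorem over_bimp : (bimp φ ψ).Over n ↔ φ.Over n ∧ ψ.Over n := by simp [bimp, Form.Over]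

theorem over_choiceCond {N d t : ℕ} (ht : t < N) : (choiceCond d t).Over (N + 3) := by
  have h1 : 1 < N + 3 := by omega
  have h2 : 2 < N + 3 := by omega
  unfold choiceCond
  split_ifs <;>
  simp [total, total₁, func, full, Form.Over, alw, ev, sub, nesub, neg, top, tag, pos, nega, ht,
    h1, h2]

theorem over_exRel {N d : ℕ} : (exRel N d φ).Over (N + 3) ↔ φ.Over (N + 3) := by
  have := over_conj (k := N) (f := choiceCond d) fun t ht => over_choiceCond ht
  simp [exRel, sub, top, Form.Over, this]

theorem over_allRel {N d : ℕ} : (allRel N d φ).Over (N + 3) ↔ φ.Over (N + 3) := over_exRel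

theorem over_now {N x : ℕ} (hx : x < N) : (now x).Over (N + 3) := by
  simp [now, pos, tag, Form.Over, hx]

theorem over_exNum {N d : ℕ} (hd : d < N) : (exNum N d φ).Over (N + 3) ↔ φ.Over (N + 3) := by
  rw [exNum, over_exRel]
  simp [isNum, pos, tag, Form.Over, hd, ev, top, nesub, neg]

theorem over_allNum {N d : ℕ} (hd : d < N) : (allNum N d φ).Over (N + 3) ↔ φ.Over (N + 3) :=
  over_exNum hd

theorem over_succ {N x y : ℕ} (hx : x < N) (hy : y < N) : (succ x y).Over (N + 3) := by
  simp [succ, ev, top, Form.Over, over_now, hx, hy]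

theorem over_lt {N x y : ℕ} (hx : x < N) (hy : y < N) : (Form.lt x y).Over (N + 3) := by
  simp [Form.lt, ev, top, Form.Over, over_now, hx, hy]

theorem over_eq {N x y : ℕ} (hx : x < N) (hy : y < N) : (Form.eq x y).Over (N + 3) := by
  simp [Form.eq, ev, top, Form.Over, over_now, hx, hy]

theorem over_holds {N r x y : ℕ} (hr : r < N) (hx : x < N) (hy : y < N) :
    (holds r x y).Over (N + 3) := by
  simp [holds, ev, top, sub, nesub, neg, pos, tag, Form.Over, over_now, hx, hy, hr]

theorem over_add {N d x y z : ℕ} (hd : d + 5 ≤ N) (hx : x < N) (hy : y < N) (hz : z < N) :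
    (Form.add N d x y z).Over (N + 3) := by
  simp (disch := omega) [Form.add, over_allRel, over_bimp, over_allNum, over_holds, over_succ,
    over_now, Form.Over]

theorem over_mul {N d x y z : ℕ} (hd : d + 10 ≤ N) (hx : x < N) (hy : y < N) (hz : z < N) :
    (Form.mul N d x y z).Over (N + 3) := by
  simp (disch := omega) [Form.mul, over_allRel, over_bimp, over_allNum, over_holds, over_succ,
    over_now, over_add, Form.Over]

/-- The condition on `en` covers the default value 0 as well, so no bound on the free variables of
the term is needed. -/
theorem over_valForm {N : ℕ} {en : List ℕ} (hen : ∀ i, en.getD i 0 < N) (t : SOA.Term) {d z : ℕ}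
    (hN : d + 3 * t.toNat + 10 ≤ N) (hz : z < N) : (valForm N en d z t).Over (N + 3) := by
  induction t generalizing d z with
  | var i => exact over_eq (hen i) hz
  | add s t ihs iht =>
    have hp1 := Nat.left_le_pair s.toNat t.toNat
    have hp2 := Nat.right_le_pair s.toNat t.toNat
    simp only [SOA.Term.toNat] at hN
    rw [valForm, over_exNum (by omega), over_exNum (by omega)]
    exact ⟨⟨ihs (by omega) (by omega), iht (by omega) (by omega)⟩,
      over_add (by omega) (by omega) (by omega) hz⟩
  | mul s t ihs iht =>
    have hp1 := Nat.left_le_pair s.toNat t.toNat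
    have hp2 := Nat.right_le_pair s.toNat t.toNat
    simp only [SOA.Term.toNat] at hN
    rw [valForm, over_exNum (by omega), over_exNum (by omega)]
    exact ⟨⟨ihs (by omega) (by omega), iht (by omega) (by omega)⟩,
      over_mul (by omega) (by omega) (by omega) hz⟩

theorem getD_cons_lt {N d : ℕ} {l : List ℕ} (hl : ∀ i, l.getD i 0 < N) (hd : d < N) (i : ℕ) :
    (d :: l).getD i 0 < N := by
  cases i with
  | zero => simpa using hd
  | succ i => simpa using hl i

theorem over_trans {N : ℕ} (φ : SOA.Form) {en es : List ℕ} {d : ℕ}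
    (hen : ∀ i, en.getD i 0 < N) (hes : ∀ i, es.getD i 0 < N)
    (hN : d + 3 * φ.toNat + 20 ≤ N) : (trans N en es d φ).Over (N + 3) := by
  induction φ generalizing en es d with
  | lt s t =>
    have hp1 := Nat.left_le_pair s.toNat t.toNat
    have hp2 := Nat.right_le_pair s.toNat t.toNat
    simp only [SOA.Form.toNat] at hN
    rw [trans, withVals, over_exNum (by omega), over_exNum (by omega)]
    exact ⟨⟨over_valForm hen s (by omega) (by omega), over_valForm hen t (by omega) (by omega)⟩,
      over_lt (by omega) (by omega)⟩
  | eq s t =>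
    have hp1 := Nat.left_le_pair s.toNat t.toNat
    have hp2 := Nat.right_le_pair s.toNat t.toNat
    simp only [SOA.Form.toNat] at hN
    rw [trans, withVals, over_exNum (by omega), over_exNum (by omega)]
    exact ⟨⟨over_valForm hen s (by omega) (by omega), over_valForm hen t (by omega) (by omega)⟩,
      over_eq (by omega) (by omega)⟩
  | mem s X =>
    have hp1 := Nat.left_le_pair s.toNat X
    simp only [SOA.Form.toNat] at hN
    rw [trans, over_exNum (by omega)]
    exact ⟨over_valForm hen s (by omega) (by omega), over_holds (hes X) (by omega) (by omega)⟩
  | not φ ih =>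
    simp only [SOA.Form.toNat] at hN
    exact ih hen hes (by omega)
  | and φ ψ ih1 ih2 =>
    have hp1 := Nat.left_le_pair φ.toNat ψ.toNat
    have hp2 := Nat.right_le_pair φ.toNat ψ.toNat
    simp only [SOA.Form.toNat] at hN
    exact ⟨ih1 hen hes (by omega), ih2 hen hes (by omega)⟩
  | or φ ψ ih1 ih2 =>
    have hp1 := Nat.left_le_pair φ.toNat ψ.toNat
    have hp2 := Nat.right_le_pair φ.toNat ψ.toNat
    simp only [SOA.Form.toNat] at hN
    exact ⟨ih1 hen hes (by omega), ih2 hen hes (by omega)⟩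
  | exNum φ ih =>
    simp only [SOA.Form.toNat] at hN
    rw [trans, over_exNum (by omega)]
    exact ih (getD_cons_lt hen (by omega)) hes (by omega)
  | allNum φ ih =>
    simp only [SOA.Form.toNat] at hN
    rw [trans, over_allNum (by omega)]
    exact ih (getD_cons_lt hen (by omega)) hes (by omega)
  | exSet φ ih =>
    simp only [SOA.Form.toNat] at hN
    rw [trans, over_exRel]
    exact ih hen (getD_cons_lt hes (by omega)) (by omega)
  | allSet φ ih =>
    simp only [SOA.Form.toNat] at hN
    rw [trans, over_allRel]
    exact ih hen (getD_cons_lt hes (by omega)) (by omega)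

theorem over_initial {N : ℕ} : (initial N).Over (N + 3) := by
  have h1 : 1 < N + 3 := by omega
  have h2 : 2 < N + 3 := by omega
  refine ⟨⟨?_, ?_, ?_⟩, ?_⟩
  · simp [once, const, alw, ev, neg, top, Form.Over, h1, h2]
  · simp only [neg, Form.Over, and_true]
    exact over_conj fun t ht => by simp [tag, Form.Over, ht]
  · refine over_conj fun t ht => ?_
    have : (onlyTag N t).Over (N + 3) := by
      refine over_conj fun t' ht' => ?_
      split_ifs <;> simp [neg, tag, Form.Over, ht']
    simp [alw, ev, top, tag, Form.Over, ht, this]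
  · exact over_conj fun t ht => by
      simp [total, total₁, full, Form.Over, alw, ev, sub, nesub, neg, top, tag, pos, nega, ht,
        h1, h2]

end Over

/-! #### The reduction formula -/

/-- Some subteam is the initial team and satisfies the translation of `φ`. -/
def redForm (N : ℕ) (φ : SOA.Form) : Form := sub (.and (initial N) (trans N [] [] 0 φ))

theorem over_redForm {N : ℕ} {φ : SOA.Form} (hN : 3 * φ.toNat + 20 ≤ N) :
    (redForm N φ).Over (N + 3) := by
  have h := over_trans (N := N) φ (en := []) (es := []) (d := 0) (by simp; omega) (by simp; omega)
    (by omega)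
  simp [redForm, sub, top, Form.Over, over_initial, h]

/-- The formula `initial N` leaves `sub` only one possible subteam, so further traces of L have no
influence. The translation starts from empty environments, and its truth is thereby tied to every
valuation at once. -/
theorem sat_redForm {N : ℕ} {φ : SOA.Form} (hN : 3 * φ.toNat + 20 ≤ N) (hφ : φ.IsSentence)
    {L : Team} (hL : Team.Over (N + 3) L) (hL' : relTeam N 0 (fun _ _ _ => False) ⊆ L) :
    Sat L (redForm N φ) ↔ SOA.Truth φ := by
  have key (g : ℕ → ℕ) (G : ℕ → Set ℕ) := sat_trans (N := N) φ (en := []) (es := [])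
    (by simp [hφ.1]) (by simp [hφ.2]) (d := 0) (ρ := fun _ _ _ => False) (g := g) (G := G)
    (by omega) (fun i hi => by simp at hi) (fun i hi => by simp at hi)
  have h : Sat L (redForm N φ) ↔
      SatAt (relTeam N 0 fun _ _ _ => False) 0 (trans N [] [] 0 φ) := by
    simp only [← satAt_zero, redForm, satAt_sub, satAt_and]
    constructor
    · rintro ⟨L', hLL', h1, h2⟩
      rwa [(satAt_initial (fun w hw => hL w (hLL' hw)) fun _ _ _ => False).1 h1] at h2
    · exact fun h => ⟨_, hL', (satAt_initial relTeam_over _).2 rfl, h⟩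
  rw [h, SOA.Truth]
  exact ⟨fun h => ⟨hφ, fun g G => (key g G).1 h⟩,
    fun h => (key (fun _ => 0) (fun _ => ∅)).2 (h.2 _ _)⟩

theorem subset_of_sat_redForm {N : ℕ} {φ : SOA.Form} {L : Team} (hL : Team.Over (N + 3) L)
    (h : Sat L (redForm N φ)) : relTeam N 0 (fun _ _ _ => False) ⊆ L := by
  simp only [← satAt_zero, redForm, satAt_sub, satAt_and] at h
  obtain ⟨L', hLL', h1, -⟩ := h
  rwa [(satAt_initial (fun w hw => hL w (hLL' hw)) fun _ _ _ => False).1 h1] at hLL'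

end InqLTL

/-! ### Computability of the reduction -/

section
variable {α σ : Type*} [Primcodable α] [Primcodable σ]

/-- A function is computable if it is defined by a recursion with at most two recursive calls
along a measure. -/
theorem Computable.of_two_calls {F : α → σ} {base : α → Bool} {b : α → σ} {l r : α → α}
    {G : α → σ → σ → σ} (μ : α → ℕ) (hbase : Computable base) (hb : Computable b)
    (hl : Computable l) (hr : Computable r)
    (hG : Computable fun p : α × σ × σ => G p.1 p.2.1 p.2.2)
    (h1 : ∀ a, base a = true → F a = b a)
    (h2 : ∀ a, base a = false →
      μ (l a) < μ a ∧ μ (r a) < μ a ∧ F a = G a (F (l a)) (F (r a))) : Computable F := by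
  -- `E c` is the partial function computed by the program c; `B c` below unfolds the recursion
  -- once, using `E c` for the recursive calls.
  let E : Nat.Partrec.Code → α →. σ := fun c a =>
    (c.eval (Encodable.encode a)).bind fun u => (Encodable.decode (α := σ) u : Part σ)
  have hE : Partrec₂ E :=
    (Nat.Partrec.Code.eval_part.comp Computable.fst
      (Computable.encode.comp Computable.snd)).bind
      ((Computable.decode.comp Computable.snd).ofOption)
  let B : Nat.Partrec.Code → α →. σ := fun c a => bif base a then Part.some (b a) else
    (E c (l a)).bind fun u => (E c (r a)).bind fun v => Part.some (G a u v)
  have hB : Partrec₂ B := by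
    refine Partrec.cond (hbase.comp Computable.snd) (hb.comp Computable.snd) ?_
    refine (hE.comp Computable.fst (hl.comp Computable.snd)).bind ?_
    refine (hE.comp (Computable.fst.comp Computable.fst)
      (hr.comp (Computable.snd.comp Computable.fst))).bind ?_
    exact (hG.comp ((Computable.snd.comp (Computable.fst.comp Computable.fst)).pair
      ((Computable.snd.comp Computable.fst).pair Computable.snd))).partrec
  let f : Nat.Partrec.Code → ℕ →. ℕ := fun c n =>
    (Encodable.decode (α := α) n : Part α).bind fun a => (B c a).map Encodable.encode
  have hf : Partrec₂ f :=
    ((Computable.decode.comp Computable.snd).ofOption).bind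
      ((hB.comp (Computable.fst.comp Computable.fst) Computable.snd).map
        (Computable.encode.comp Computable.snd))
  -- Kleene's second recursion theorem gives a program that computes its own unfolding. Arguments
  -- other than the measure may change freely in the calls.
  obtain ⟨c, hc⟩ := Nat.Partrec.Code.fixed_point₂ hf
  -- The measure enters only in this termination proof and need not be computable.
  have hEF : ∀ n a, μ a = n → E c a = Part.some (F a) := by
    intro n
    induction n using Nat.strong_induction_on with
    | _ n ih =>
      rintro a rfl
      have hBa : B c a = Part.some (F a) := by
        cases hba : base a with
        | true => simp [B, hba, h1 a hba]
        | false =>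
          obtain ⟨hl', hr', hF⟩ := h2 a hba
          simp [B, hba, ih _ hl' _ rfl, ih _ hr' _ rfl, hF]
      simp only [E]
      rw [hc]
      simp [f, hBa]
  exact (hE.comp (Computable.const c) Computable.id).of_eq fun a => hEF _ a rfl

variable {f g : α → σ} {m n : α → ℕ}

theorem Computable.ite_eq (hm : Computable m) (hn : Computable n) (hf : Computable f)
    (hg : Computable g) : Computable fun a => if m a = n a then f a else g a :=
  (Computable.cond ((Primrec.eq (α := ℕ)).decide.to_comp.comp hm hn) hf hg).of_eq fun a => by
    by_cases h : m a = n a <;> simp [h]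

theorem Computable.ite_lt (hm : Computable m) (hn : Computable n) (hf : Computable f)
    (hg : Computable g) : Computable fun a => if m a < n a then f a else g a :=
  (Computable.cond (Primrec.nat_lt.decide.to_comp.comp hm hn) hf hg).of_eq fun a => by
    by_cases h : m a < n a <;> simp [h]

theorem Computable.add_const (hm : Computable m) (k : ℕ) : Computable fun a => m a + k :=
  (Primrec.nat_add.comp Primrec.id (Primrec.const k)).to_comp.comp hm

theorem Computable.div_const (hm : Computable m) (k : ℕ) : Computable fun a => m a / k :=
  (Primrec.nat_div.comp Primrec.id (Primrec.const k)).to_comp.comp hm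

theorem Computable.mod_const (hm : Computable m) (k : ℕ) : Computable fun a => m a % k :=
  (Primrec.nat_mod.comp Primrec.id (Primrec.const k)).to_comp.comp hm

theorem Computable.unpair_fst (hm : Computable m) : Computable fun a => (Nat.unpair (m a)).1 :=
  Computable.fst.comp (Computable.unpair.comp hm)

theorem Computable.unpair_snd (hm : Computable m) : Computable fun a => (Nat.unpair (m a)).2 :=
  Computable.snd.comp (Computable.unpair.comp hm)

theorem Computable.list_getD_zero {l : α → List ℕ} (hl : Computable l) (hm : Computable m) :
    Computable fun a => (l a).getD (m a) 0 :=
  ((Primrec.list_getD 0).to_comp.comp hl hm)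

end

namespace InqLTL

open Form

section
variable {α : Type*} [Primcodable α] {φ ψ : α → Form} {N d t x y z p : α → ℕ}

/-- Encoding is the Gödel numbering itself, so a constructor is primitive recursive as soon as its
effect on Gödel numbers is. -/
theorem computable_mk₁ {c : ℕ} {C : Form → Form} (hC : ∀ φ, (C φ).toNat = 8 * φ.toNat + c)
    (hφ : Computable φ) : Computable fun a => C (φ a) := by
  have h : Primrec C := Primrec.encode_iff.1
    ((Primrec.nat_add.comp (Primrec.nat_mul.comp (.const 8) Primrec.encode) (.const c)).of_eq
      fun a => (hC a).symm)
  exact h.to_comp.comp hφ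

theorem computable_mk₂ {c : ℕ} {C : Form → Form → Form}
    (hC : ∀ φ ψ, (C φ ψ).toNat = 8 * Nat.pair φ.toNat ψ.toNat + c)
    (hφ : Computable φ) (hψ : Computable ψ) : Computable fun a => C (φ a) (ψ a) := by
  have h : Primrec₂ C := Primrec.encode_iff.1
    ((Primrec.nat_add.comp (Primrec.nat_mul.comp (.const 8) (Primrec₂.natPair.comp
      (Primrec.encode.comp Primrec.fst) (Primrec.encode.comp Primrec.snd))) (.const c)).of_eq
      fun a => (hC a.1 a.2).symm)
  exact h.to_comp.comp hφ hψ

theorem computable_atom (hp : Computable p) : Computable fun a => Form.atom (p a) := by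
  have h : Primrec Form.atom := Primrec.encode_iff.1
    ((Primrec.nat_add.comp (Primrec.nat_mul.comp (.const 8) Primrec.id) (.const 1)).of_eq
      fun a => rfl)
  exact h.to_comp.comp hp

theorem computable_or (hφ : Computable φ) (hψ : Computable ψ) :
    Computable fun a => Form.or (φ a) (ψ a) := computable_mk₂ (fun _ _ => rfl) hφ hψ

theorem computable_and (hφ : Computable φ) (hψ : Computable ψ) :
    Computable fun a => Form.and (φ a) (ψ a) := computable_mk₂ (fun _ _ => rfl) hφ hψ

theorem computable_imp (hφ : Computable φ) (hψ : Computable ψ) :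
    Computable fun a => Form.imp (φ a) (ψ a) := computable_mk₂ (fun _ _ => rfl) hφ hψ

theorem computable_untl (hφ : Computable φ) (hψ : Computable ψ) :
    Computable fun a => Form.untl (φ a) (ψ a) := computable_mk₂ (fun _ _ => rfl) hφ hψ

theorem computable_next (hφ : Computable φ) : Computable fun a => Form.next (φ a) :=
  computable_mk₁ (fun _ => rfl) hφ

theorem computable_bneg (hφ : Computable φ) : Computable fun a => Form.bneg (φ a) :=
  computable_mk₁ (fun _ => rfl) hφ

theorem computable_neg (hφ : Computable φ) : Computable fun a => neg (φ a) :=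
  computable_imp hφ (.const Form.bot)

theorem computable_ev (hφ : Computable φ) : Computable fun a => ev (φ a) :=
  computable_untl (.const top) hφ

theorem computable_alw (hφ : Computable φ) : Computable fun a => alw (φ a) :=
  computable_bneg (computable_ev (computable_bneg hφ))

theorem computable_sub (hφ : Computable φ) : Computable fun a => sub (φ a) :=
  computable_bneg (computable_imp hφ (.const (Form.bneg top)))

theorem computable_nesub (hφ : Computable φ) : Computable fun a => nesub (φ a) :=
  computable_bneg (computable_neg hφ)

theorem computable_bimp (hφ : Computable φ) (hψ : Computable ψ) :
    Computable fun a => bimp (φ a) (ψ a) := computable_or (computable_bneg hφ) hψ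

theorem computable_conj {f : α → ℕ → Form} (hN : Computable N) (hf : Computable₂ f) :
    Computable fun a => conj (N a) (f a) :=
  Computable.nat_rec hN (.const top)
    (h := fun a (p : ℕ × Form) => Form.and (f a p.1) p.2)
    (computable_and (hf.comp Computable.fst (Computable.fst.comp Computable.snd))
      (Computable.snd.comp Computable.snd))

theorem computable_tag (ht : Computable t) : Computable fun a => tag (t a) :=
  computable_atom (ht.add_const 3)

theorem computable_pos (ht : Computable t) : Computable fun a => pos (t a) :=
  computable_and (computable_tag ht) (.const _)

theorem computable_nega (ht : Computable t) : Computable fun a => nega (t a) :=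
  computable_and (computable_tag ht) (.const _)

theorem computable_total (hφ : Computable φ) : Computable fun a => total (φ a) :=
  have h (p q : ℕ) : Computable fun a => total₁ (φ a) p q :=
    computable_alw (computable_sub (computable_and (computable_and hφ (.const _)) (.const _)))
  computable_and (h 0 1) (h 1 0)

theorem computable_func (ht : Computable t) : Computable fun a => func (t a) :=
  computable_bneg (computable_sub (computable_and (computable_and (computable_tag ht) (.const _))
    (.const _)))

theorem computable_full (ht : Computable t) : Computable fun a => full (t a) :=
  computable_and (computable_total (computable_pos ht)) (computable_total (computable_nega ht))

theorem computable_choiceCond (hd : Computable d) (ht : Computable t) :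
    Computable fun a => choiceCond (d a) (t a) :=
  have h := computable_total (computable_tag ht)
  .ite_lt ht hd h (.ite_eq ht hd (computable_and h (computable_func ht)) (computable_full ht))

theorem computable_exRel (hN : Computable N) (hd : Computable d) (hφ : Computable φ) :
    Computable fun a => exRel (N a) (d a) (φ a) :=
  computable_sub (computable_and
    (computable_conj hN (computable_choiceCond (hd.comp .fst) .snd)) hφ)

theorem computable_allRel (hN : Computable N) (hd : Computable d) (hφ : Computable φ) :
    Computable fun a => allRel (N a) (d a) (φ a) :=
  computable_bneg (computable_exRel hN hd (computable_bneg hφ))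

theorem computable_now (hx : Computable x) : Computable fun a => now (x a) :=
  computable_imp (computable_pos hx) (.const _)

theorem computable_exNum (hN : Computable N) (hd : Computable d) (hφ : Computable φ) :
    Computable fun a => exNum (N a) (d a) (φ a) :=
  computable_exRel hN hd (computable_and (computable_and (computable_nesub (computable_pos hd))
    (computable_ev (computable_imp (computable_pos hd) (.const _)))) hφ)

theorem computable_allNum (hN : Computable N) (hd : Computable d) (hφ : Computable φ) :
    Computable fun a => allNum (N a) (d a) (φ a) :=
  computable_bneg (computable_exNum hN hd (computable_bneg hφ))

theorem computable_succ (hx : Computable x) (hy : Computable y) :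
    Computable fun a => Form.succ (x a) (y a) :=
  computable_ev (computable_and (computable_now hx) (computable_next (computable_now hy)))

theorem computable_lt (hx : Computable x) (hy : Computable y) :
    Computable fun a => Form.lt (x a) (y a) :=
  computable_ev (computable_and (computable_now hx)
    (computable_next (computable_ev (computable_now hy))))

theorem computable_eq (hx : Computable x) (hy : Computable y) :
    Computable fun a => Form.eq (x a) (y a) :=
  computable_ev (computable_and (computable_now hx) (computable_now hy))

theorem computable_holds (ht : Computable t) (hx : Computable x) (hy : Computable y) :
    Computable fun a => holds (t a) (x a) (y a) :=
  computable_sub (computable_and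
    (computable_and (computable_nesub (computable_pos ht))
      (computable_and (computable_nesub (computable_pos hx)) (computable_nesub (computable_pos hy))))
    (computable_and (computable_ev (computable_and (computable_now hx) (computable_now ht)))
      (computable_ev (computable_and (computable_now hy)
        (computable_imp (computable_pos ht) (.const _))))))

theorem computable_add (hN : Computable N) (hd : Computable d) (hx : Computable x)
    (hy : Computable y) (hz : Computable z) :
    Computable fun a => Form.add (N a) (d a) (x a) (y a) (z a) := by
  have h (k : ℕ) := hd.add_const k
  exact computable_allRel hN hd (computable_bimp (computable_and
    (computable_allNum hN (h 1) (computable_bimp (computable_now (h 1))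
      (computable_holds hd (h 1) hx)))
    (computable_allNum hN (h 1) (computable_allNum hN (h 2) (computable_allNum hN (h 3)
      (computable_allNum hN (h 4) (computable_bimp
        (computable_and (computable_holds hd (h 1) (h 2)) (computable_and
          (computable_succ (h 1) (h 3)) (computable_succ (h 2) (h 4))))
        (computable_holds hd (h 3) (h 4))))))))
    (computable_holds hd hy hz))

theorem computable_mul (hN : Computable N) (hd : Computable d) (hx : Computable x)
    (hy : Computable y) (hz : Computable z) :
    Computable fun a => Form.mul (N a) (d a) (x a) (y a) (z a) := by
  have h (k : ℕ) := hd.add_const k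
  exact computable_allRel hN hd (computable_bimp (computable_and
    (computable_allNum hN (h 1) (computable_bimp (computable_now (h 1))
      (computable_holds hd (h 1) (h 1))))
    (computable_allNum hN (h 1) (computable_allNum hN (h 2) (computable_allNum hN (h 3)
      (computable_allNum hN (h 4) (computable_bimp
        (computable_and (computable_holds hd (h 1) (h 2)) (computable_and
          (computable_succ (h 1) (h 3)) (computable_add hN (h 5) (h 2) hx (h 4))))
        (computable_holds hd (h 3) (h 4))))))))
    (computable_holds hd hy hz))

theorem computable_initial (hN : Computable N) : Computable fun a => initial (N a) := by
  refine computable_and (computable_and (.const _) (computable_and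
    (computable_neg (computable_conj hN (computable_neg (computable_tag .snd))))
    (computable_conj hN ?_))) (computable_conj hN (computable_full .snd))
  refine computable_imp (computable_tag .snd) (computable_alw
    (computable_conj (hN.comp .fst) ?_))
  exact .ite_eq .snd (Computable.snd.comp .fst) (computable_tag .snd)
    (computable_neg (computable_tag .snd))

end

/-! #### Terms and formulas of second-order arithmetic -/

/-- The tags d and z change in the recursive calls, so all parameters are packed into one argument
whose measure is the Gödel number c. Sums and products make the same calls and differ only in the
last conjunct. -/
theorem computable_valForm {α : Type*} [Primcodable α] {N d z c : α → ℕ} {en : α → List ℕ}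
    (hN : Computable N) (hen : Computable en) (hd : Computable d) (hz : Computable z)
    (hc : Computable c) :
    Computable fun a => valForm (N a) (en a) (d a) (z a) (SOA.Term.ofNat (c a)) := by
  suffices h : Computable fun q : ℕ × List ℕ × ℕ × ℕ × ℕ =>
      valForm q.1 q.2.1 q.2.2.1 q.2.2.2.1 (SOA.Term.ofNat q.2.2.2.2) from
    h.comp (hN.pair (hen.pair (hd.pair (hz.pair hc))))
  have pN : Computable fun q : ℕ × List ℕ × ℕ × ℕ × ℕ => q.1 := .fst
  have pen : Computable fun q : ℕ × List ℕ × ℕ × ℕ × ℕ => q.2.1 := Computable.fst.comp .snd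
  have p3 : Computable fun q : ℕ × List ℕ × ℕ × ℕ × ℕ => q.2.2 := Computable.snd.comp .snd
  have pd : Computable fun q : ℕ × List ℕ × ℕ × ℕ × ℕ => q.2.2.1 := Computable.fst.comp p3
  have p4 : Computable fun q : ℕ × List ℕ × ℕ × ℕ × ℕ => q.2.2.2 := Computable.snd.comp p3
  have pz : Computable fun q : ℕ × List ℕ × ℕ × ℕ × ℕ => q.2.2.2.1 := Computable.fst.comp p4
  have pc : Computable fun q : ℕ × List ℕ × ℕ × ℕ × ℕ => q.2.2.2.2 := Computable.snd.comp p4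
  refine Computable.of_two_calls
    (base := fun q => if q.2.2.2.2 % 3 = 0 then true else false)
    (b := fun q => Form.eq (q.2.1.getD (q.2.2.2.2 / 3) 0) q.2.2.2.1)
    (l := fun q => (q.1, q.2.1, q.2.2.1 + 2, q.2.2.1, (Nat.unpair (q.2.2.2.2 / 3)).1))
    (r := fun q => (q.1, q.2.1, q.2.2.1 + 2, q.2.2.1 + 1, (Nat.unpair (q.2.2.2.2 / 3)).2))
    (G := fun q u v => exNum q.1 q.2.2.1 (exNum q.1 (q.2.2.1 + 1) (.and (.and u v)
      (if q.2.2.2.2 % 3 = 1 then Form.add q.1 (q.2.2.1 + 2) q.2.2.1 (q.2.2.1 + 1) q.2.2.2.1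
        else Form.mul q.1 (q.2.2.1 + 2) q.2.2.1 (q.2.2.1 + 1) q.2.2.2.1))))
    (fun q => q.2.2.2.2) ?_ ?_ ?_ ?_ ?_ ?_ ?_
  · exact .ite_eq (pc.mod_const 3) (.const 0) (.const _) (.const _)
  · exact computable_eq (pen.list_getD_zero (pc.div_const 3)) pz
  · exact pN.pair (pen.pair ((pd.add_const 2).pair (pd.pair (pc.div_const 3).unpair_fst)))
  · exact pN.pair (pen.pair ((pd.add_const 2).pair ((pd.add_const 1).pair
      (pc.div_const 3).unpair_snd)))
  · have qN := pN.comp (Computable.fst (α := ℕ × List ℕ × ℕ × ℕ × ℕ) (β := Form × Form))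
    have qd := pd.comp (Computable.fst (α := ℕ × List ℕ × ℕ × ℕ × ℕ) (β := Form × Form))
    have qz := pz.comp (Computable.fst (α := ℕ × List ℕ × ℕ × ℕ × ℕ) (β := Form × Form))
    have qc := pc.comp (Computable.fst (α := ℕ × List ℕ × ℕ × ℕ × ℕ) (β := Form × Form))
    exact computable_exNum qN qd (computable_exNum qN (qd.add_const 1) (computable_and
      (computable_and (Computable.fst.comp .snd) (Computable.snd.comp .snd))
      (.ite_eq (qc.mod_const 3) (.const 1)
        (computable_add qN (qd.add_const 2) qd (qd.add_const 1) qz)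
        (computable_mul qN (qd.add_const 2) qd (qd.add_const 1) qz))))
  · rintro ⟨N, en, d, z, c⟩ hq
    have hc : c % 3 = 0 := by simpa using hq
    dsimp only
    rw [SOA.Term.ofNat, dif_pos hc, valForm]
  · rintro ⟨N, en, d, z, c⟩ hq
    have hc : c % 3 ≠ 0 := by simpa using hq
    have hlt : c / 3 < c := by omega
    refine ⟨(Nat.unpair_left_le _).trans_lt hlt, (Nat.unpair_right_le _).trans_lt hlt, ?_⟩
    dsimp only
    rw [SOA.Term.ofNat, dif_neg hc]
    split_ifs <;> rw [valForm]

theorem computable_term_numBound : Computable fun c => (SOA.Term.ofNat c).numBound := by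
  refine Computable.of_two_calls
    (base := fun c => if c % 3 = 0 then true else false) (b := fun c => c / 3 + 1)
    (l := fun c => (Nat.unpair (c / 3)).1) (r := fun c => (Nat.unpair (c / 3)).2)
    (G := fun _ u v => max u v) id ?_ ?_ ?_ ?_ ?_ ?_ ?_
  · exact .ite_eq (Computable.id.mod_const 3) (.const 0) (.const _) (.const _)
  · exact (Computable.id.div_const 3).add_const 1
  · exact (Computable.id.div_const 3).unpair_fst
  · exact (Computable.id.div_const 3).unpair_snd
  · exact Primrec.nat_max.to_comp.comp (Computable.fst.comp .snd) (Computable.snd.comp .snd)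
  · intro c hq
    have hc : c % 3 = 0 := by simpa using hq
    rw [SOA.Term.ofNat, dif_pos hc, SOA.Term.numBound]
  · intro c hq
    have hc : c % 3 ≠ 0 := by simpa using hq
    have hlt : c / 3 < c := by omega
    refine ⟨(Nat.unpair_left_le _).trans_lt hlt, (Nat.unpair_right_le _).trans_lt hlt, ?_⟩
    rw [SOA.Term.ofNat, dif_neg hc]
    split_ifs <;> rw [SOA.Term.numBound]

end InqLTL

namespace InqLTL

open Form

/-- Together with `computable_form_setBound` this lets the reduction recognise sentences. The
residue mod 10 is the constructor; residues below 3 are the atomic formulas. -/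
theorem computable_form_numBound : Computable fun c => (SOA.Form.ofNat c).numBound := by
  have hc : Computable fun c : ℕ => c := .id
  have hm := hc.mod_const 10
  have h1 := (hc.div_const 10).unpair_fst
  have h2 := (hc.div_const 10).unpair_snd
  refine Computable.of_two_calls
    (base := fun c => if c % 10 < 3 then true else false)
    (b := fun c => if c % 10 = 2 then (SOA.Term.ofNat (Nat.unpair (c / 10)).1).numBound else
      max (SOA.Term.ofNat (Nat.unpair (c / 10)).1).numBound
        (SOA.Term.ofNat (Nat.unpair (c / 10)).2).numBound)
    (l := fun c => if c % 10 = 4 then (Nat.unpair (c / 10)).1 else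
      if c % 10 = 5 then (Nat.unpair (c / 10)).1 else c / 10)
    -- For unary constructors the second call is a dummy: it must decrease the measure, but `G`
    -- ignores its result.
    (r := fun c => (Nat.unpair (c / 10)).2)
    (G := fun c u v => if c % 10 = 4 then max u v else if c % 10 = 5 then max u v else
      if c % 10 = 6 then u - 1 else if c % 10 = 7 then u - 1 else u) id ?_ ?_ ?_ ?_ ?_ ?_ ?_
  · exact .ite_lt hm (.const 3) (.const _) (.const _)
  · exact .ite_eq hm (.const 2) (computable_term_numBound.comp h1)
      (Primrec.nat_max.to_comp.comp (computable_term_numBound.comp h1)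
        (computable_term_numBound.comp h2))
  · exact .ite_eq hm (.const 4) h1 (.ite_eq hm (.const 5) h1 (hc.div_const 10))
  · exact h2
  · have hm' := hm.comp (Computable.fst (α := ℕ) (β := ℕ × ℕ))
    have hu := Computable.fst.comp (Computable.snd (α := ℕ) (β := ℕ × ℕ))
    have hv := Computable.snd.comp (Computable.snd (α := ℕ) (β := ℕ × ℕ))
    have hp := Computable.pred.comp hu
    have hx := Primrec.nat_max.to_comp.comp hu hv
    exact .ite_eq hm' (.const 4) hx (.ite_eq hm' (.const 5) hx (.ite_eq hm' (.const 6) hp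
      (.ite_eq hm' (.const 7) hp hu)))
  · intro c hq
    have hc : c % 10 < 3 := by simpa using hq
    rw [SOA.Form.ofNat]
    obtain hr | hr | hr : c % 10 = 0 ∨ c % 10 = 1 ∨ c % 10 = 2 := by omega
    all_goals simp [hr, SOA.Form.numBound]
  · intro c hq
    have hc : ¬ c % 10 < 3 := by simpa using hq
    have hlt : c / 10 < c := by omega
    refine ⟨?_, (Nat.unpair_right_le _).trans_lt hlt, ?_⟩
    · dsimp only [id]
      split_ifs
      · exact (Nat.unpair_left_le _).trans_lt hlt
      · exact (Nat.unpair_left_le _).trans_lt hlt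
      · exact hlt
    · rw [SOA.Form.ofNat]
      obtain hr | hr | hr | hr | hr | hr | hr : c % 10 = 3 ∨ c % 10 = 4 ∨ c % 10 = 5 ∨
        c % 10 = 6 ∨ c % 10 = 7 ∨ c % 10 = 8 ∨ c % 10 = 9 := by omega
      all_goals simp [hr, SOA.Form.numBound]

theorem computable_form_setBound : Computable fun c => (SOA.Form.ofNat c).setBound := by
  have hc : Computable fun c : ℕ => c := .id
  have hm := hc.mod_const 10
  have h1 := (hc.div_const 10).unpair_fst
  have h2 := (hc.div_const 10).unpair_snd
  refine Computable.of_two_calls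
    (base := fun c => if c % 10 < 3 then true else false)
    (b := fun c => if c % 10 = 2 then (Nat.unpair (c / 10)).2 + 1 else 0)
    (l := fun c => if c % 10 = 4 then (Nat.unpair (c / 10)).1 else
      if c % 10 = 5 then (Nat.unpair (c / 10)).1 else c / 10)
    (r := fun c => (Nat.unpair (c / 10)).2)
    (G := fun c u v => if c % 10 = 4 then max u v else if c % 10 = 5 then max u v else
      if c % 10 = 8 then u - 1 else if c % 10 = 9 then u - 1 else u) id ?_ ?_ ?_ ?_ ?_ ?_ ?_
  · exact .ite_lt hm (.const 3) (.const _) (.const _)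
  · exact .ite_eq hm (.const 2) (h2.add_const 1) (.const 0)
  · exact .ite_eq hm (.const 4) h1 (.ite_eq hm (.const 5) h1 (hc.div_const 10))
  · exact h2
  · have hm' := hm.comp (Computable.fst (α := ℕ) (β := ℕ × ℕ))
    have hu := Computable.fst.comp (Computable.snd (α := ℕ) (β := ℕ × ℕ))
    have hv := Computable.snd.comp (Computable.snd (α := ℕ) (β := ℕ × ℕ))
    have hp := Computable.pred.comp hu
    have hx := Primrec.nat_max.to_comp.comp hu hv
    exact .ite_eq hm' (.const 4) hx (.ite_eq hm' (.const 5) hx (.ite_eq hm' (.const 8) hp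
      (.ite_eq hm' (.const 9) hp hu)))
  · intro c hq
    have hc : c % 10 < 3 := by simpa using hq
    rw [SOA.Form.ofNat]
    obtain hr | hr | hr : c % 10 = 0 ∨ c % 10 = 1 ∨ c % 10 = 2 := by omega
    all_goals simp [hr, SOA.Form.setBound]
  · intro c hq
    have hc : ¬ c % 10 < 3 := by simpa using hq
    have hlt : c / 10 < c := by omega
    refine ⟨?_, (Nat.unpair_right_le _).trans_lt hlt, ?_⟩
    · dsimp only [id]
      split_ifs
      · exact (Nat.unpair_left_le _).trans_lt hlt
      · exact (Nat.unpair_left_le _).trans_lt hlt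
      · exact hlt
    · rw [SOA.Form.ofNat]
      obtain hr | hr | hr | hr | hr | hr | hr : c % 10 = 3 ∨ c % 10 = 4 ∨ c % 10 = 5 ∨
        c % 10 = 6 ∨ c % 10 = 7 ∨ c % 10 = 8 ∨ c % 10 = 9 := by omega
      all_goals simp [hr, SOA.Form.setBound]

theorem computable_trans : Computable fun q : ℕ × List ℕ × List ℕ × ℕ × ℕ =>
    trans q.1 q.2.1 q.2.2.1 q.2.2.2.1 (SOA.Form.ofNat q.2.2.2.2) := by
  have pN : Computable fun q : ℕ × List ℕ × List ℕ × ℕ × ℕ => q.1 := .fst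
  have pen : Computable fun q : ℕ × List ℕ × List ℕ × ℕ × ℕ => q.2.1 := Computable.fst.comp .snd
  have p3 : Computable fun q : ℕ × List ℕ × List ℕ × ℕ × ℕ => q.2.2 := Computable.snd.comp .snd
  have pes : Computable fun q : ℕ × List ℕ × List ℕ × ℕ × ℕ => q.2.2.1 := Computable.fst.comp p3
  have p4 : Computable fun q : ℕ × List ℕ × List ℕ × ℕ × ℕ => q.2.2.2 := Computable.snd.comp p3
  have pd : Computable fun q : ℕ × List ℕ × List ℕ × ℕ × ℕ => q.2.2.2.1 := Computable.fst.comp p4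
  have pc : Computable fun q : ℕ × List ℕ × List ℕ × ℕ × ℕ => q.2.2.2.2 := Computable.snd.comp p4
  have hm := pc.mod_const 10
  have h0 := pc.div_const 10
  have h1 := h0.unpair_fst
  have h2 := h0.unpair_snd
  have pdn := Computable.list_cons.comp pd pen
  have pds := Computable.list_cons.comp pd pes
  have pd1 := pd.add_const 1
  have pd2 := pd.add_const 2
  refine Computable.of_two_calls
    (base := fun q => if q.2.2.2.2 % 10 < 3 then true else false)
    (b := fun q =>
      if q.2.2.2.2 % 10 = 2 then
        exNum q.1 q.2.2.2.1 (.and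
          (valForm q.1 q.2.1 (q.2.2.2.1 + 1) q.2.2.2.1
            (SOA.Term.ofNat (Nat.unpair (q.2.2.2.2 / 10)).1))
          (Form.holds (q.2.2.1.getD (Nat.unpair (q.2.2.2.2 / 10)).2 0) q.2.2.2.1 q.2.2.2.1))
      else withVals q.1 q.2.1 q.2.2.2.1 (SOA.Term.ofNat (Nat.unpair (q.2.2.2.2 / 10)).1)
        (SOA.Term.ofNat (Nat.unpair (q.2.2.2.2 / 10)).2)
        (if q.2.2.2.2 % 10 = 0 then Form.lt q.2.2.2.1 (q.2.2.2.1 + 1)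
          else Form.eq q.2.2.2.1 (q.2.2.2.1 + 1)))
    -- By residue: 3 is negation, 4 and 5 are binary, 6 and 7 push d onto the number environment, 8
    -- and 9 push it onto the set environment.
    (l := fun q =>
      if q.2.2.2.2 % 10 < 4 then (q.1, q.2.1, q.2.2.1, q.2.2.2.1, q.2.2.2.2 / 10) else
      if q.2.2.2.2 % 10 < 6 then
        (q.1, q.2.1, q.2.2.1, q.2.2.2.1, (Nat.unpair (q.2.2.2.2 / 10)).1) else
      if q.2.2.2.2 % 10 < 8 then
        (q.1, q.2.2.2.1 :: q.2.1, q.2.2.1, q.2.2.2.1 + 1, q.2.2.2.2 / 10) else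
        (q.1, q.2.1, q.2.2.2.1 :: q.2.2.1, q.2.2.2.1 + 1, q.2.2.2.2 / 10))
    (r := fun q => (q.1, q.2.1, q.2.2.1, q.2.2.2.1, (Nat.unpair (q.2.2.2.2 / 10)).2))
    (G := fun q u v =>
      if q.2.2.2.2 % 10 = 3 then .bneg u else
      if q.2.2.2.2 % 10 = 4 then .and u v else
      if q.2.2.2.2 % 10 = 5 then .or u v else
      if q.2.2.2.2 % 10 = 6 then exNum q.1 q.2.2.2.1 u else
      if q.2.2.2.2 % 10 = 7 then allNum q.1 q.2.2.2.1 u else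
      if q.2.2.2.2 % 10 = 8 then exRel q.1 q.2.2.2.1 u else allRel q.1 q.2.2.2.1 u)
    (fun q => q.2.2.2.2) ?_ ?_ ?_ ?_ ?_ ?_ ?_
  · exact .ite_lt hm (.const 3) (.const _) (.const _)
  · exact .ite_eq hm (.const 2)
      (computable_exNum pN pd (computable_and (computable_valForm pN pen pd1 pd h1)
        (computable_holds (pes.list_getD_zero h2) pd pd)))
      (computable_exNum pN pd (computable_exNum pN pd1 (computable_and
        (computable_and (computable_valForm pN pen pd2 pd h1)
          (computable_valForm pN pen pd2 pd1 h2))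
        (.ite_eq hm (.const 0) (computable_lt pd pd1) (computable_eq pd pd1)))))
  · exact .ite_lt hm (.const 4) (pN.pair (pen.pair (pes.pair (pd.pair h0))))
      (.ite_lt hm (.const 6) (pN.pair (pen.pair (pes.pair (pd.pair h1))))
      (.ite_lt hm (.const 8) (pN.pair (pdn.pair (pes.pair (pd1.pair h0))))
        (pN.pair (pen.pair (pds.pair (pd1.pair h0))))))
  · exact pN.pair (pen.pair (pes.pair (pd.pair h2)))
  · have qN := pN.comp (Computable.fst (α := ℕ × List ℕ × List ℕ × ℕ × ℕ) (β := Form × Form))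
    have qd := pd.comp (Computable.fst (α := ℕ × List ℕ × List ℕ × ℕ × ℕ) (β := Form × Form))
    have qm := hm.comp (Computable.fst (α := ℕ × List ℕ × List ℕ × ℕ × ℕ) (β := Form × Form))
    have hu := Computable.fst.comp
      (Computable.snd (α := ℕ × List ℕ × List ℕ × ℕ × ℕ) (β := Form × Form))
    have hv := Computable.snd.comp
      (Computable.snd (α := ℕ × List ℕ × List ℕ × ℕ × ℕ) (β := Form × Form))
    exact .ite_eq qm (.const 3) (computable_bneg hu)
      (.ite_eq qm (.const 4) (computable_and hu hv)
      (.ite_eq qm (.const 5) (computable_or hu hv)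
      (.ite_eq qm (.const 6) (computable_exNum qN qd hu)
      (.ite_eq qm (.const 7) (computable_allNum qN qd hu)
      (.ite_eq qm (.const 8) (computable_exRel qN qd hu) (computable_allRel qN qd hu))))))
  · rintro ⟨N, en, es, d, c⟩ hq
    have hc : c % 10 < 3 := by simpa using hq
    dsimp only
    rw [SOA.Form.ofNat]
    obtain hr | hr | hr : c % 10 = 0 ∨ c % 10 = 1 ∨ c % 10 = 2 := by omega
    all_goals simp [hr, trans]
  · rintro ⟨N, en, es, d, c⟩ hq
    have hc : ¬ c % 10 < 3 := by simpa using hq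
    have hlt : c / 10 < c := by omega
    refine ⟨?_, (Nat.unpair_right_le _).trans_lt hlt, ?_⟩
    · dsimp only
      split_ifs
      · exact hlt
      · exact (Nat.unpair_left_le _).trans_lt hlt
      · exact hlt
      · exact hlt
    · dsimp only
      rw [SOA.Form.ofNat]
      obtain hr | hr | hr | hr | hr | hr | hr : c % 10 = 3 ∨ c % 10 = 4 ∨ c % 10 = 5 ∨
        c % 10 = 6 ∨ c % 10 = 7 ∨ c % 10 = 8 ∨ c % 10 = 9 := by omega
      all_goals simp [hr, trans]

/-! ### The reductions -/

/-- The number of tags that suffices for the translation of `φ`. -/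
def tagCount (φ : SOA.Form) : ℕ := 3 * φ.toNat + 20

open Classical in
/-- The formula to which a formula of second-order arithmetic is reduced; it is unsatisfiable if
the latter is not a sentence. -/
noncomputable def reduction (φ : SOA.Form) : Form :=
  if φ.IsSentence then redForm (tagCount φ) φ else .bneg top

theorem computable_tagCount : Computable tagCount :=
  ((Primrec.nat_mul.comp (.const 3) Primrec.id).to_comp.comp Computable.encode).add_const 20

theorem computable_reduction : Computable reduction := by
  have hcode : Computable SOA.Form.toNat := Computable.encode
  have hN := computable_tagCount
  have hred : Computable fun φ : SOA.Form => redForm (tagCount φ) φ :=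
    (computable_sub (computable_and (computable_initial hN) (computable_trans.comp
      (hN.pair ((Computable.const []).pair ((Computable.const []).pair
        ((Computable.const 0).pair hcode))))))).of_eq fun φ => by
          simp only [SOA.Form.ofNat_toNat]; rfl
  have h1 : Computable fun φ : SOA.Form => φ.numBound :=
    (computable_form_numBound.comp hcode).of_eq fun φ => by rw [SOA.Form.ofNat_toNat]
  have h2 : Computable fun φ : SOA.Form => φ.setBound :=
    (computable_form_setBound.comp hcode).of_eq fun φ => by rw [SOA.Form.ofNat_toNat]
  refine (Computable.ite_eq h1 (.const 0) (.ite_eq h2 (.const 0) hred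
    (.const (Form.bneg top))) (.const (Form.bneg top))).of_eq fun φ => ?_
  by_cases h1 : φ.numBound = 0 <;> by_cases h2 : φ.setBound = 0 <;>
    simp [reduction, SOA.Form.IsSentence, h1, h2]

theorem over_reduction (φ : SOA.Form) : (reduction φ).Over (tagCount φ + 3) := by
  unfold reduction
  split_ifs
  · exact over_redForm le_rfl
  · simp [top, Form.Over]

/-- One criterion for both problems: the full team satisfies the inclusion trivially, and the traces
of `kripkeCode` satisfy it by `relTeam_subset_traces`. Both sides fail if φ is not a sentence. -/
theorem sat_reduction {φ : SOA.Form} {L : Team} (hL : Team.Over (tagCount φ + 3) L) :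
    Sat L (reduction φ) ↔
      SOA.Truth φ ∧ relTeam (tagCount φ) 0 (fun _ _ _ => False) ⊆ L := by
  unfold reduction
  split_ifs with h
  · constructor
    · intro hs
      have hsub := subset_of_sat_redForm hL hs
      exact ⟨(sat_redForm le_rfl h hL hsub).1 hs, hsub⟩
    · rintro ⟨ht, hsub⟩
      exact (sat_redForm le_rfl h hL hsub).2 ht
  · have : ¬ SOA.Truth φ := fun ht => h ht.1
    simp [← satAt_zero, satAt_bneg, satAt_top, this]

theorem truth_reducible_satisfiability : ManyOneReducible SOA.Truth Satisfiability := by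
  refine ⟨fun φ => (tagCount φ + 3, reduction φ),
    (computable_tagCount.add_const 3).pair computable_reduction, fun φ => ?_⟩
  simp only [Satisfiability, over_reduction, true_and]
  constructor
  · intro h
    refine ⟨relTeam (tagCount φ) 0 fun _ _ _ => False, relTeam_over, ?_,
      (sat_reduction relTeam_over).2 ⟨h, le_rfl⟩⟩
    exact ⟨tr 0 True 0 0, mem_relTeam.2 ⟨by simp [tagCount], by simp⟩⟩
  · rintro ⟨L, hL, -, h⟩
    exact ((sat_reduction hL).1 h).1

/-! ### A Kripke structure whose traces include the initial team -/

/-- The propositions at state `j` of the Kripke structure `kripkeCode N`. -/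
def label (j : ℕ) : List ℕ :=
  (if j % 2 = 1 then [0] else []) ++ ((if j / 2 % 2 = 1 then [1] else []) ++
    ((if j / 4 % 2 = 1 then [2] else []) ++ [j / 8 + 3]))

/-- The complete Kripke structure whose states are the labels with exactly one of `N` tags. -/
def kripkeCode (N : ℕ) : KripkeCode :=
  (List.range (8 * N)).map fun j => (true, List.range (8 * N), label j)

theorem primrec_label : Primrec label := by
  have h (k : ℕ) : PrimrecPred fun j : ℕ => j / k % 2 = 1 :=
    Primrec.eq.comp (Primrec.nat_mod.comp (Primrec.nat_div.comp .id (.const k)) (.const 2))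
      (.const 1)
  have h' : PrimrecPred fun j : ℕ => j % 2 = 1 :=
    Primrec.eq.comp (Primrec.nat_mod.comp .id (.const 2)) (.const 1)
  exact Primrec.list_append.comp (.ite h' (.const _) (.const _))
    (Primrec.list_append.comp (.ite (h 2) (.const _) (.const _))
      (Primrec.list_append.comp (.ite (h 4) (.const _) (.const _))
        (Primrec.list_cons.comp (Primrec.nat_add.comp (Primrec.nat_div.comp .id (.const 8))
          (.const 3)) (.const []))))

theorem computable_kripkeCode : Computable kripkeCode := by
  have h : Primrec fun N : ℕ => List.range (8 * N) :=
    Primrec.list_range.comp (Primrec.nat_mul.comp (.const 8) .id)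
  exact (Primrec.list_map h ((Primrec.const true).pair ((h.comp .fst).pair
    (primrec_label.comp .snd))).to₂).to_comp

theorem isKripkeOver_kripkeCode {N : ℕ} (hN : 0 < N) :
    KripkeCode.IsKripkeOver (N + 3) (kripkeCode N) := by
  constructor
  · simp [kripkeCode]; omega
  · intro e he
    simp only [kripkeCode, List.mem_map, List.mem_range] at he
    obtain ⟨j, hj, rfl⟩ := he
    refine ⟨by simp; omega, by simp [kripkeCode], ?_⟩
    intro p hp
    simp only [label, List.mem_append, List.mem_ite_nil_right, List.mem_singleton] at hp
    omega

theorem traces_over {n : ℕ} {c : KripkeCode} (h : KripkeCode.IsKripkeOver n c) :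
    Team.Over n (KripkeCode.toKripke n c h).traces := by
  rintro w ⟨π, -, -, rfl⟩ i p hp
  exact (h.2 _ (List.get_mem c (π i))).2.2 p hp

/-- The three lowest binary digits of a state are the truth values of the propositions 0, 1, 2, and
the rest is the tag. -/
theorem mem_label {t : ℕ} {a b c p : ℕ} (ha : a < 2) (hb : b < 2) (hc : c < 2) :
    p ∈ label (8 * t + 4 * c + 2 * b + a) ↔
      (p = 0 ∧ a = 1) ∨ (p = 1 ∧ b = 1) ∨ (p = 2 ∧ c = 1) ∨ p = t + 3 := by
  simp only [label, List.mem_append, List.mem_ite_nil_right, List.mem_singleton]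
  have e1 : (8 * t + 4 * c + 2 * b + a) % 2 = a := by omega
  have e2 : (8 * t + 4 * c + 2 * b + a) / 2 % 2 = b := by omega
  have e3 : (8 * t + 4 * c + 2 * b + a) / 4 % 2 = c := by omega
  have e4 : (8 * t + 4 * c + 2 * b + a) / 8 = t := by omega
  rw [e1, e2, e3, e4]
  tauto

/-- All states are initial and all transitions are allowed, so any sequence of labels is a trace.
The inclusion is strict in general, for example because tags may change along a path; the `sub` in
`redForm` absorbs the excess. -/
theorem relTeam_subset_traces {N : ℕ} {ρ : ℕ → ℕ → ℕ → Prop}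
    (h : KripkeCode.IsKripkeOver (N + 3) (kripkeCode N)) :
    relTeam N 0 ρ ⊆ (KripkeCode.toKripke (N + 3) (kripkeCode N) h).traces := by
  classical
  rintro w ⟨t, s, n, m, rfl, ht, -⟩
  have hlen : (kripkeCode N).length = 8 * N := by simp [kripkeCode]
  have hbit (q : Prop) [Decidable q] : (if q then 1 else 0) < 2 := by split_ifs <;> omega
  let st (i : ℕ) : ℕ :=
    8 * t + 4 * (if s then 1 else 0) + 2 * (if i = m then 1 else 0) + (if i = n then 1 else 0)
  have hst (i : ℕ) : st i < (kripkeCode N).length := by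
    have := hbit s; have := hbit (i = m); have := hbit (i = n)
    rw [hlen]; simp only [st]; omega
  refine ⟨fun i => ⟨st i, hst i⟩, ?_, fun i => ?_, ?_⟩
  · change ((kripkeCode N).get ⟨st 0, hst 0⟩).1 = true
    simp [kripkeCode]
  · have := hst (i + 1)
    rw [hlen] at this
    simpa [KripkeCode.toKripke, kripkeCode] using this
  · funext i
    ext p
    have := mem_label (t := t) (p := p) (hbit (i = n)) (hbit (i = m)) (hbit s)
    change p ∈ tr t s n m i ↔ p ∈ ((kripkeCode N).get ⟨st i, hst i⟩).2.2
    have hl : ((kripkeCode N).get ⟨st i, hst i⟩).2.2 = label (st i) := by simp [kripkeCode]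
    rw [hl, this]
    simp [tr]

theorem truth_reducible_modelChecking : ManyOneReducible SOA.Truth ModelChecking := by
  refine ⟨fun φ => (tagCount φ + 3, kripkeCode (tagCount φ), reduction φ),
    (computable_tagCount.add_const 3).pair
      ((computable_kripkeCode.comp computable_tagCount).pair computable_reduction), fun φ => ?_⟩
  have hK := isKripkeOver_kripkeCode (N := tagCount φ) (by simp [tagCount])
  simp only [ModelChecking, over_reduction, true_and]
  constructor
  · exact fun h => ⟨hK, (sat_reduction (traces_over hK)).2 ⟨h, relTeam_subset_traces hK⟩⟩
  · rintro ⟨hK', h⟩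
    exact ((sat_reduction (traces_over hK')).1 h).1

end InqLTL

/-! ### Second-order arithmetic is undecidable -/

namespace SOA

/-- `w = Nat.pair u v` for the number variables `u`, `v`, `w`. -/
def pairForm (u v w : ℕ) : Form :=
  .or (.and (.lt (.var u) (.var v)) (.eq (.var w) (.add (.mul (.var v) (.var v)) (.var u))))
    (.and (.not (.lt (.var u) (.var v)))
      (.eq (.var w) (.add (.add (.mul (.var u) (.var u)) (.var u)) (.var v))))

/-- The two disjuncts are the two branches in the definition of `Nat.pair`. -/
theorem holds_pairForm {u v w : ℕ} {g : ℕ → ℕ} {G : ℕ → Set ℕ} :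
    Holds g G (pairForm u v w) ↔ g w = Nat.pair (g u) (g v) := by
  simp only [pairForm, Holds, Term.val, Nat.pair]
  split_ifs with h <;> simp [h]

/-- The number variable `u` is `0`. -/
def zeroForm (u : ℕ) : Form := .eq (.add (.var u) (.var u)) (.var u)

theorem holds_zeroForm {u : ℕ} {g : ℕ → ℕ} {G : ℕ → Set ℕ} :
    Holds g G (zeroForm u) ↔ g u = 0 := by
  simp [zeroForm, Holds, Term.val]

/-- The number variable `u` is `1`. -/
def oneForm (u : ℕ) : Form :=
  .and (.eq (.mul (.var u) (.var u)) (.var u)) (.not (zeroForm u))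

theorem holds_oneForm {u : ℕ} {g : ℕ → ℕ} {G : ℕ → Set ℕ} :
    Holds g G (oneForm u) ↔ g u = 1 := by
  simp only [oneForm, Holds, Term.val, holds_zeroForm]
  constructor
  · rintro ⟨h1, h2⟩
    exact Nat.eq_of_mul_eq_mul_left (Nat.pos_of_ne_zero h2) (by simpa using h1)
  · intro h; simp [h]

/-- `v = u + 1` for the number variables `u`, `v`. -/
def succForm (u v : ℕ) : Form :=
  .exNum (.and (oneForm 0) (.eq (.var (v + 1)) (.add (.var (u + 1)) (.var 0))))

theorem holds_succForm {u v : ℕ} {g : ℕ → ℕ} {G : ℕ → Set ℕ} :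
    Holds g G (succForm u v) ↔ g v = g u + 1 := by
  simp [succForm, Holds, Term.val, holds_oneForm, push]

/-- Boolean implication. -/
def Form.imp (φ ψ : Form) : Form := .or (.not φ) ψ

theorem holds_imp {φ ψ : Form} {g : ℕ → ℕ} {G : ℕ → Set ℕ} :
    Holds g G (φ.imp ψ) ↔ (Holds g G φ → Holds g G ψ) := by
  simp [Form.imp, Holds, imp_iff_not_or]

theorem numBound_pairForm (u v w : ℕ) : (pairForm u v w).numBound = max (max u v) w + 1 := by
  simp only [pairForm, Form.numBound, Term.numBound]
  omega

theorem setBound_pairForm (u v w : ℕ) : (pairForm u v w).setBound = 0 := rfl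

theorem numBound_zeroForm (u : ℕ) : (zeroForm u).numBound = u + 1 := by
  simp [zeroForm, Form.numBound, Term.numBound]

theorem setBound_zeroForm (u : ℕ) : (zeroForm u).setBound = 0 := rfl

theorem numBound_succForm (u v : ℕ) : (succForm u v).numBound = max u v + 1 := by
  simp only [succForm, oneForm, zeroForm, Form.numBound, Term.numBound]
  omega

theorem setBound_succForm (u v : ℕ) : (succForm u v).setBound = 0 := rfl

theorem numBound_imp (φ ψ : Form) : (φ.imp ψ).numBound = max φ.numBound ψ.numBound := rfl

theorem setBound_imp (φ ψ : Form) : (φ.imp ψ).setBound = max φ.setBound ψ.setBound := rfl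

/-- The graph of the partial function `f` is definable without set parameters. -/
def Definable (f : ℕ →. ℕ) : Prop :=
  ∀ i j : ℕ, ∃ φ : Form, (φ.numBound ≤ max i j + 1 ∧ φ.setBound = 0) ∧
    ∀ g G, Holds g G φ ↔ g j ∈ f (g i)

/-- The graph of a primitive recursion is the least set of coded pairs closed under its equations,
so membership in it is a quantification over sets. This avoids coding finite sequences. -/
theorem mem_prec_iff {f g : ℕ →. ℕ} {a n y : ℕ} :
    (y ∈ (n.rec (f a) fun y IH => IH.bind fun i => g (Nat.pair a (Nat.pair y i)) : Part ℕ)) ↔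
      ∀ X : Set ℕ, (∀ v, v ∈ f a → Nat.pair 0 v ∈ X) →
        (∀ k i w, Nat.pair k i ∈ X → w ∈ g (Nat.pair a (Nat.pair k i)) →
          Nat.pair (k + 1) w ∈ X) → Nat.pair n y ∈ X := by
  constructor
  · intro h X h0 h1
    induction n generalizing y with
    | zero => exact h0 y h
    | succ n ih =>
      obtain ⟨i, hi, hy⟩ := Part.mem_bind_iff.1 h
      exact h1 n i y (ih hi) hy
  · intro h
    -- The graph itself is one of the closed sets.
    have := h {c | (Nat.unpair c).2 ∈
      ((Nat.unpair c).1.rec (f a) fun y IH => IH.bind fun i => g (Nat.pair a (Nat.pair y i)) :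
        Part ℕ)} (by simp) ?_
    · simpa using this
    · intro k i w hk hw
      simp only [Set.mem_ofPred_eq, Nat.unpair_pair] at hk ⊢
      exact Part.mem_bind_iff.2 ⟨i, hk, hw⟩

/-- Induction on the generation of partial recursive functions. Since `Definable` supplies a formula
for any input and output indices, composing graphs needs no substitution: the indices are chosen to
fit below the new quantifiers. -/
theorem definable_of_partrec {f : ℕ →. ℕ} (hf : Nat.Partrec f) : Definable f := by
  induction hf with
  | zero =>
    intro i j
    refine ⟨zeroForm j, ?_, fun g G => ?_⟩
    · simp [zeroForm, Form.numBound, Form.setBound, Term.numBound]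
    · rw [holds_zeroForm]
      exact Part.mem_some_iff.symm
  | succ =>
    intro i j
    refine ⟨succForm i j, ?_, fun g G => ?_⟩
    · simp [numBound_succForm, setBound_succForm]
    · rw [holds_succForm]
      exact Part.mem_some_iff.symm
  | left =>
    intro i j
    refine ⟨.exNum (pairForm (j + 1) 0 (i + 1)), ?_, fun g G => ?_⟩
    · simp [pairForm, Form.numBound, Form.setBound, Term.numBound]
    · simp only [Holds, holds_pairForm, push]
      refine Iff.trans ?_ Part.mem_some_iff.symm
      constructor
      · rintro ⟨n, h⟩; simp [h]
      · intro h; exact ⟨(Nat.unpair (g i)).2, by simp [h]⟩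
  | right =>
    intro i j
    refine ⟨.exNum (pairForm 0 (j + 1) (i + 1)), ?_, fun g G => ?_⟩
    · simp [pairForm, Form.numBound, Form.setBound, Term.numBound]
    · simp only [Holds, holds_pairForm, push]
      refine Iff.trans ?_ Part.mem_some_iff.symm
      constructor
      · rintro ⟨n, h⟩; simp [h]
      · intro h; exact ⟨(Nat.unpair (g i)).1, by simp [h]⟩
  | pair _ _ ihf ihg =>
    intro i j
    obtain ⟨φ, ⟨hφ, hφ'⟩, Hφ⟩ := ihf (i + 2) 1
    obtain ⟨ψ, ⟨hψ, hψ'⟩, Hψ⟩ := ihg (i + 2) 0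
    refine ⟨.exNum (.exNum (.and (.and φ ψ) (pairForm 1 0 (j + 2)))), ?_, fun g G => ?_⟩
    · simp only [numBound_pairForm, setBound_pairForm, Form.numBound, Form.setBound]
      omega
    · simp [Holds, Hφ, Hψ, holds_pairForm, push, Seq.seq, and_assoc, eq_comm]
  | comp _ _ ihf ihg =>
    intro i j
    obtain ⟨φ, ⟨hφ, hφ'⟩, Hφ⟩ := ihf 0 (j + 1)
    obtain ⟨ψ, ⟨hψ, hψ'⟩, Hψ⟩ := ihg (i + 1) 0
    refine ⟨.exNum (.and ψ φ), ?_, fun g G => ?_⟩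
    · simp only [Form.numBound, Form.setBound]
      omega
    · simp only [Holds, Hφ, Hψ, push]
      exact Part.mem_bind_iff.symm
  | @prec f h _ _ ihf ihg =>
    intro i j
    obtain ⟨φ, ⟨hφ, hφ'⟩, Hφ⟩ := ihf 2 0
    obtain ⟨ψ, ⟨hψ, hψ'⟩, Hψ⟩ := ihg 2 4
    -- The input is the pair of a and n. The seven quantifiers of the step clause bind, outermost
    -- first, k, i, w, the pair (k, i), the pair of a with it, k + 1 and the pair (k + 1, w); there
    -- n and a have the indices 7 and 8.
    refine ⟨.exNum (.exNum (.and (pairForm 1 0 (i + 2)) (.allSet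
      ((Form.allNum (φ.imp (.allNum (.allNum
        ((Form.and (zeroForm 1) (pairForm 1 2 0)).imp (.mem (.var 0) 0)))))).imp
      ((Form.allNum (.allNum (.allNum (.allNum (.allNum (.allNum (.allNum
        ((Form.and (.and (pairForm 6 5 3) (pairForm 8 3 2))
          (.and (.and (succForm 6 1) (pairForm 1 4 0)) (.and (.mem (.var 3) 0) ψ))).imp
            (.mem (.var 0) 0))))))))).imp
      (.allNum ((pairForm 1 (j + 3) 0).imp (.mem (.var 0) 0)))))))), ?_, fun g G => ?_⟩
    · constructor
      · simp only [numBound_pairForm, numBound_zeroForm, numBound_succForm, numBound_imp,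
          Form.numBound, Term.numBound]
        norm_num
        omega
      · simp [setBound_pairForm, setBound_zeroForm, setBound_succForm, setBound_imp,
          Form.setBound, hφ', hψ']
    · simp only [Holds, holds_imp, holds_pairForm, holds_zeroForm, holds_succForm, Hφ, Hψ, push,
        Term.val]
      refine Iff.trans ?_ (mem_prec_iff (f := f) (g := h) (a := (Nat.unpair (g i)).1)
        (n := (Nat.unpair (g i)).2)).symm
      constructor
      · rintro ⟨a, n, hg, H⟩ X h0 h1
        rw [hg, Nat.unpair_pair] at h0 h1 ⊢
        refine H X ?_ ?_ _ rfl
        · rintro v hv z p ⟨rfl, rfl⟩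
          exact h0 v hv
        · rintro k i w p q k' r ⟨⟨rfl, rfl⟩, ⟨rfl, rfl⟩, hp, hw⟩
          exact h1 k i w hp hw
      · intro H
        refine ⟨(Nat.unpair (g i)).1, (Nat.unpair (g i)).2, (Nat.pair_unpair _).symm, ?_⟩
        rintro X h0 h1 _ rfl
        exact H X (fun v hv => h0 v hv _ _ ⟨rfl, rfl⟩) fun k i w hk hw =>
          h1 k i w _ _ _ _ ⟨⟨rfl, rfl⟩, ⟨rfl, rfl⟩, hk, hw⟩
  | @rfind f _ ihf =>
    intro i j
    obtain ⟨φ, ⟨hφ, hφ'⟩, Hφ⟩ := ihf 1 0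
    -- The second conjunct demands a nonzero value at each smaller argument, and with it that the
    -- function is defined there.
    refine ⟨.and (.exNum (.exNum (.and (.and (pairForm (i + 2) (j + 2) 1) (zeroForm 0)) φ)))
      (.allNum ((Form.lt (.var 0) (.var (j + 1))).imp
        (.exNum (.exNum (.and (.and (pairForm (i + 3) 2 1) (.not (zeroForm 0))) φ))))),
      ?_, fun g G => ?_⟩
    · simp only [numBound_pairForm, numBound_zeroForm, numBound_imp, setBound_pairForm,
        setBound_zeroForm, setBound_imp, Form.numBound, Form.setBound, Term.numBound]
      omega
    · refine Iff.trans ?_ Nat.mem_rfind.symm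
      simp only [Holds, holds_imp, holds_pairForm, holds_zeroForm, Hφ, push, Term.val,
        Part.map_eq_map, Part.mem_map_iff, decide_eq_true_eq, decide_eq_false_iff_not]
      constructor
      · rintro ⟨⟨_, m, ⟨rfl, hm⟩, h⟩, H⟩
        refine ⟨⟨m, h, hm⟩, fun {k} hk => ?_⟩
        obtain ⟨_, m', ⟨rfl, hm'⟩, h'⟩ := H k hk
        exact ⟨m', h', hm'⟩
      · rintro ⟨⟨m, h, hm⟩, H⟩
        refine ⟨⟨_, m, ⟨rfl, hm⟩, h⟩, fun k hk => ?_⟩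
        obtain ⟨m', h', hm'⟩ := H hk
        exact ⟨_, m', ⟨rfl, hm'⟩, h'⟩

/-! #### The halting problem -/

/-- The numeral `n`, where the number variables `2` and `1` stand for `0` and `1`. -/
def numeral (n : ℕ) : Term := Nat.rec (.var 2) (fun _ t => .add t (.var 1)) n

theorem numBound_numeral (n : ℕ) : (numeral n).numBound ≤ 3 := by
  induction n with
  | zero => simp [numeral, Term.numBound]
  | succ n ih =>
    change max (numeral n).numBound 2 ≤ 3
    omega

theorem val_numeral {g : ℕ → ℕ} (h0 : g 2 = 0) (h1 : g 1 = 1) (n : ℕ) :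
    (numeral n).val g = n := by
  induction n with
  | zero => exact h0
  | succ n ih =>
    change (numeral n).val g + g 1 = n + 1
    rw [ih, h1]

theorem primrec_numeral : Primrec numeral := by
  have hadd : Primrec fun t : Term => Term.add t (.var 1) := Primrec.encode_iff.1
    ((Primrec.nat_add.comp (Primrec.nat_mul.comp (.const 3) (Primrec₂.natPair.comp
      Primrec.encode (.const (Term.var 1).toNat))) (.const 1)).of_eq fun t => rfl)
  exact Primrec.nat_rec₁ _ (hadd.comp Primrec.snd).to₂

/-- The sentence `∃ x y, x = n ∧ φ(x, y)`, where the free number variables of `φ` are `1`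
and `0`. -/
def instanceForm (φ : Form) (n : ℕ) : Form :=
  .exNum (.and (zeroForm 0) (.exNum (.and (oneForm 0) (.exNum
    (.and (.eq (.var 0) (numeral n)) (.exNum φ))))))

/-- The signature has no constants, so 0 and 1 are first quantified and pinned down; at the numeral
they have the indices 2 and 1. Below the last quantifier the input is variable 1 and the output
variable 0. -/
theorem holds_instanceForm {φ : Form} {n : ℕ} {f : ℕ →. ℕ}
    (hφ : ∀ g G, Holds g G φ ↔ g 0 ∈ f (g 1)) {g : ℕ → ℕ} {G : ℕ → Set ℕ} :
    Holds g G (instanceForm φ n) ↔ (f n).Dom := by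
  simp only [instanceForm, Holds, holds_zeroForm, holds_oneForm, Term.val, hφ, push,
    exists_eq_left, Part.dom_iff_mem]
  constructor
  · rintro ⟨x, hx, y, hy⟩
    rw [val_numeral rfl rfl] at hx
    exact ⟨y, hx ▸ hy⟩
  · rintro ⟨y, hy⟩
    exact ⟨n, (val_numeral rfl rfl n).symm, y, hy⟩

theorem primrec_instanceForm (φ : Form) : Primrec (instanceForm φ) := by
  have hex {f : ℕ → Form} (hf : Primrec f) : Primrec fun n => Form.exNum (f n) :=
    Primrec.encode_iff.1 ((Primrec.nat_add.comp (Primrec.nat_mul.comp (.const 10)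
      (Primrec.encode.comp hf)) (.const 6)).of_eq fun t => rfl)
  have hand {f g : ℕ → Form} (hf : Primrec f) (hg : Primrec g) :
      Primrec fun n => Form.and (f n) (g n) :=
    Primrec.encode_iff.1 ((Primrec.nat_add.comp (Primrec.nat_mul.comp (.const 10)
      (Primrec₂.natPair.comp (Primrec.encode.comp hf) (Primrec.encode.comp hg)))
      (.const 4)).of_eq fun t => rfl)
  have heq : Primrec fun n => Form.eq (.var 0) (numeral n) :=
    Primrec.encode_iff.1 ((Primrec.nat_add.comp (Primrec.nat_mul.comp (.const 10)
      (Primrec₂.natPair.comp (.const (Term.var 0).toNat) (Primrec.encode.comp primrec_numeral)))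
      (.const 1)).of_eq fun t => rfl)
  exact hex (hand (.const _) (hex (hand (.const _) (hex (hand heq (.const _))))))

/-- A single formula φ defines the graph of the function that runs the program with a given code on
input 0. Its instance at the code of c is a sentence that is true iff c halts on 0. -/
theorem not_computable_truth : ¬ ComputablePred Truth := by
  intro h
  let f : ℕ →. ℕ := fun n => (Denumerable.ofNat Nat.Partrec.Code n).eval 0
  have hf : Nat.Partrec f := Partrec.nat_iff.1
    (Nat.Partrec.Code.eval_part.comp (Computable.ofNat _) (Computable.const 0))
  obtain ⟨φ, ⟨hφ, hφ'⟩, Hφ⟩ := definable_of_partrec hf 1 0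
  refine ComputablePred.halting_problem 0 (ComputablePred.computable_of_manyOneReducible
    (q := Truth) ⟨fun c => instanceForm φ (Encodable.encode c),
      (primrec_instanceForm φ).to_comp.comp Computable.encode, fun c => ?_⟩ h)
  have hs : (instanceForm φ (Encodable.encode c)).IsSentence := by
    have := numBound_numeral (Encodable.encode c)
    simp only [Form.IsSentence, instanceForm, zeroForm, oneForm, Form.numBound, Form.setBound,
      Term.numBound]
    omega
  simp only [Truth, hs, true_and, holds_instanceForm Hφ, f, Denumerable.ofNat_encode,
    forall_const]

end SOA

/-! ### The main theorem -/

theorem mainTheorem2 :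
    ¬ ComputablePred InqLTL.ModelChecking ∧
    ¬ ComputablePred InqLTL.Satisfiability ∧
    ManyOneReducible SOA.Truth InqLTL.ModelChecking ∧
    ManyOneReducible SOA.Truth InqLTL.Satisfiability := by
  have hM := InqLTL.truth_reducible_modelChecking
  have hS := InqLTL.truth_reducible_satisfiability
  exact ⟨fun h => SOA.not_computable_truth (ComputablePred.computable_of_manyOneReducible hM h),
    fun h => SOA.not_computable_truth (ComputablePred.computable_of_manyOneReducible hS h), hM, hS⟩
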